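/- Let $q$ be a prime power, $L=\operatorname{PSL}_2(q)$, and let $p\neq 2$ be a prime dividing $q-1$. There is an irreducible $\mathbb{F}_pL$-module on which $L$ acts nontrivially and which lies in the principal $p$-block of $L$ (the block of $\mathbb{F}_pL$ containing the trivial module). Every such module $V$ has dimension $q$ and satisfies $\mathbb{F}_p\oplus V\cong P$, where $\mathbb{F}_p$ is the trivial module and $P$ is the $(q+1)$-dimensional permutation $\mathbb{F}_pL$-module of the natural action of $L$ on the projective line $\mathbb{P}^1(\mathbb{F}_q)$; in particular $V$ is unique up to isomorphism. Moreover, $$H^1(L,V)\cong H^2(L,V)\cong \mathbb{F}_p .$$ -/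

import Mathlib

open scoped MatrixGroups LinearAlgebra.Projectivization

noncomputable section

namespace ModularRep

variable {k G V : Type*} [Field k] [Group G] [AddCommGroup V] [Module k V]

/-- A block idempotent of the group algebra `k[G]`: a primitive idempotent of its center. Block
idempotents correspond to the blocks of `k[G]`. -/
structure IsBlockIdempotent (e : MonoidAlgebra k G) : Prop where
  central : e ∈ Subalgebra.center k (MonoidAlgebra k G)
  idem : IsIdempotentElem e
  ne_zero : e ≠ 0
  primitive : ∀ f ∈ Subalgebra.center k (MonoidAlgebra k G),
    IsIdempotentElem f → f * e = f → f = 0 ∨ f = e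

/-- A representation belongs to the block with block idempotent `e` if `e` acts as the
identity. -/
def BelongsToBlock (ρ : Representation k G V) (e : MonoidAlgebra k G) : Prop :=
  ρ.asAlgebraHom e = 1

/-- A representation belongs to the principal block if it belongs to the block that contains the
one-dimensional trivial representation. -/
def InPrincipalBlock (ρ : Representation k G V) : Prop :=
  ∃ e : MonoidAlgebra k G, IsBlockIdempotent e ∧
    BelongsToBlock (Representation.trivial k G k) e ∧ BelongsToBlock ρ e

/-- A nonprincipal irreducible representation in the principal block: it is irreducible, the group
acts nontrivially, and it belongs to the same block as the trivial representation. -/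
structure IsNonprincipalIrreducibleInPrincipalBlock (ρ : Representation k G V) : Prop where
  irreducible : ρ.IsIrreducible
  nonprincipal : ¬ ρ.IsTrivial
  principalBlock : InPrincipalBlock ρ

end ModularRep

/-- The permutation module over `ZMod p` of `PSL(2, F)` acting naturally on the projective line
over `F`. -/
abbrev projectiveLinePermutationModule (p : ℕ) (F : Type) [Field F] :
    Representation (ZMod p) PSL(2, F) (MonoidAlgebra (ZMod p) (ℙ F (Fin 2 → F))) :=
  Representation.ofMulAction (ZMod p) PSL(2, F) (ℙ F (Fin 2 → F))

end

/-! Let `q = |F|`, `G = PSL(2, F)`, let `B` be the stabilizer of a point of the projective line, and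
let `p ^ n` be the `p`-part of `q - 1`. Then `B = K ⋊ ⟨s⟩` with `K` of order prime to `p`, `s`
diagonal of order `p ^ n` and inverted by a Weyl element `w`. Since `q + 1` is `2` modulo the odd
prime `p`, the index of `⟨s⟩` is prime to `p` both in `B` and in `G`. Everything below uses only
these facts, packaged as `IsRankOneData`.

Existence: every central element of the group algebra acts on the permutation module `P` by its
augmentation (`center_apply`), because conjugation by `s` acts without fixed points on the elements
taking the base point to its image under `w`. The vectors of coefficient sum zero form an
irreducible submodule (`mem_of_coeffSum_eq_zero`).

Uniqueness: the sum over all points of the elements of the conjugates of `K` is central with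
augmentation `2|K| ≠ 0`, so it acts injectively on any module in the principal block. This yields a
nonzero `K`-fixed vector, and then a `B`-fixed one because `s` acts unipotently (`exists_fixed`). By
Frobenius reciprocity `P` maps onto `V`, and together with the coefficient sum this gives `P ≅ 𝔽_p ⊕
V` (`nonempty_equiv`).

Cohomology: Shapiro's lemma gives `Hⁱ(G, P) ≅ Hⁱ(B, 𝔽_p)`. For `i = 1, 2`, trivial-coefficient
classes of `B` and `G` are detected on `⟨s⟩`. They vanish for `G`, since `w` inverts `s` and so acts
by `-1` on the detecting invariant. For `B` they form a line, spanned by the class pulled back from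
the cyclic quotient `B / K`. -/

noncomputable section

/-! ### Augmentation and the principal block idempotent. -/

namespace ModularRep

variable {k G V : Type*} [Field k] [Group G] [AddCommGroup V] [Module k V]

variable (k G) in
/-- The augmentation of the group algebra. -/
def augmentation : MonoidAlgebra k G →ₐ[k] k := MonoidAlgebra.lift k k G 1

@[simp]
lemma augmentation_single (g : G) (c : k) :
    augmentation k G (MonoidAlgebra.single g c) = c := by
  simp [augmentation]

lemma asAlgebraHom_trivial (a : MonoidAlgebra k G) (c : k) :
    (Representation.trivial k G k).asAlgebraHom a c = augmentation k G a * c := by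
  induction a using MonoidAlgebra.induction_linear with
  | zero => simp
  | add x y hx hy => simp [hx, hy, add_mul]
  | single g r => simp

lemma belongsToBlock_trivial_iff (e : MonoidAlgebra k G) :
    BelongsToBlock (Representation.trivial k G k) e ↔ augmentation k G e = 1 := by
  constructor
  · intro h
    have := asAlgebraHom_trivial e 1
    rw [h] at this
    simpa using this.symm
  · intro h
    ext
    simp [asAlgebraHom_trivial, h]

omit [Group G] in
lemma finite_monoidAlgebra [Finite k] [Finite G] : Finite (MonoidAlgebra k G) := by
  have : Finite (G →₀ k) := Finite.of_injective _ (DFunLike.coe_injective (F := G →₀ k))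
  exact Finite.of_equiv _ (MonoidAlgebra.coeffEquiv (R := k) (M := G)).symm

lemma exists_isIdempotentElem_pow {M : Type*} [Monoid M] [Finite M] (z : M) :
    ∃ n ≠ 0, IsIdempotentElem (z ^ n) := by
  obtain ⟨i, j, hne, hij⟩ := Finite.exists_ne_map_eq_of_infinite (fun n : ℕ => z ^ n)
  wlog hlt : i < j generalizing i j
  · exact this j i hne.symm hij.symm (by omega)
  obtain ⟨d, rfl⟩ := Nat.exists_eq_add_of_lt hlt
  set e := d + 1 with he
  have h1 : ∀ m, z ^ (i + m * e) = z ^ i := by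
    intro m
    induction m with
    | zero => simp
    | succ m ih =>
      rw [show i + (m + 1) * e = (i + m * e) + e by ring, pow_add, ih, ← pow_add]
      exact hij.symm
  -- Powers have period `e` from exponent `i` on, so any positive multiple of `e` that is at least
  -- `i` gives an idempotent.
  refine ⟨(i + 1) * e, by positivity, ?_⟩
  rw [IsIdempotentElem, ← pow_add]
  have h2 : i ≤ (i + 1) * e := by nlinarith
  obtain ⟨r, hr⟩ := Nat.exists_eq_add_of_le h2
  calc z ^ ((i + 1) * e + (i + 1) * e) = z ^ (i + (i + 1) * e + r) := by
        congr 1; omega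
    _ = z ^ ((i + 1) * e) := by rw [pow_add, h1, ← pow_add, ← hr]

variable (k G) in
/-- A finite group algebra over a finite field has a block idempotent of augmentation one. -/
lemma exists_principal_isBlockIdempotent [Finite k] [Finite G] :
    ∃ e : MonoidAlgebra k G, IsBlockIdempotent e ∧
      BelongsToBlock (Representation.trivial k G k) e := by
  classical
  have := finite_monoidAlgebra (k := k) (G := G)
  let Z := Subalgebra.center k (MonoidAlgebra k G)
  let S : Set Z := {f | IsIdempotentElem f ∧ augmentation k G f = 1}
  have hS : S.Finite := Set.toFinite _
  -- The product is the smallest central idempotent of augmentation one. If `f ≤ e` has augmentation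
  -- zero, then `e - f` is again a factor, so `e * (e - f) = e` and `f = 0`.
  let e : Z := ∏ f ∈ hS.toFinset, f
  have heI : IsIdempotentElem e := by
    rw [IsIdempotentElem, ← Finset.prod_mul_distrib]
    refine Finset.prod_congr rfl fun f hf => ?_
    exact (hS.mem_toFinset.1 hf).1
  have hea : augmentation k G (e : MonoidAlgebra k G) = 1 := by
    change ((augmentation k G).comp Z.val) e = 1
    rw [map_prod]
    exact Finset.prod_eq_one fun f hf => (hS.mem_toFinset.1 hf).2
  have hle : ∀ f ∈ S, e * f = e := by
    intro f hf
    have : f ∈ hS.toFinset := hS.mem_toFinset.2 hf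
    change (∏ f ∈ hS.toFinset, f) * f = ∏ f ∈ hS.toFinset, f
    rw [← Finset.mul_prod_erase _ _ this, mul_comm, ← mul_assoc, hf.1]
  refine ⟨e, ⟨e.2, congrArg Subtype.val heI, ?_, ?_⟩, (belongsToBlock_trivial_iff _).2 hea⟩
  · intro h
    rw [h, map_zero] at hea
    exact zero_ne_one hea
  · intro f hf hfI hfe
    let f' : Z := ⟨f, hf⟩
    have hf'I : IsIdempotentElem f' := Subtype.ext hfI
    have hf'e : f' * e = f' := Subtype.ext hfe
    have haI : augmentation k G f * augmentation k G f = augmentation k G f := by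
      rw [← map_mul, hfI]
    rcases (IsIdempotentElem.iff_eq_zero_or_one.1 haI) with h0 | h1
    · left
      have hef : (e : MonoidAlgebra k G) * f = f := by
        rw [← (Subalgebra.mem_center_iff.1 e.2) f, hfe]
      have heI' : (e : MonoidAlgebra k G) * e = e := congrArg Subtype.val heI
      have hmem : (⟨(e : MonoidAlgebra k G) - f, sub_mem e.2 hf⟩ : Z) ∈ S := by
        refine ⟨Subtype.ext ?_, ?_⟩
        · change ((e : MonoidAlgebra k G) - f) * (e - f) = e - f
          rw [sub_mul, mul_sub, mul_sub, heI', hfe, hef, hfI, sub_self, sub_zero]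
        · change augmentation k G ((e : MonoidAlgebra k G) - f) = 1
          rw [map_sub, hea, h0, sub_zero]
      have : (e : MonoidAlgebra k G) * (e - f) = e := congrArg Subtype.val (hle _ hmem)
      rwa [mul_sub, heI', hef, sub_eq_self] at this
    · right
      have := hle f' ⟨hf'I, h1⟩
      rw [mul_comm, hf'e] at this
      exact congrArg Subtype.val this

/-- A central element of nonzero augmentation acts injectively on representations in the principal
block. -/
lemma InPrincipalBlock.apply_ne_zero [Finite k] [Finite G] {ρ : Representation k G V}
    (h : InPrincipalBlock ρ) {z : MonoidAlgebra k G}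
    (hz : z ∈ Subalgebra.center k (MonoidAlgebra k G)) (hza : augmentation k G z ≠ 0)
    {v : V} (hv : v ≠ 0) : ρ.asAlgebraHom z v ≠ 0 := by
  have := finite_monoidAlgebra (k := k) (G := G)
  obtain ⟨e, he, het, heV⟩ := h
  rw [belongsToBlock_trivial_iff] at het
  obtain ⟨n, hn, hI⟩ := exists_isIdempotentElem_pow z
  have hzn : z ^ n ∈ Subalgebra.center k (MonoidAlgebra k G) := pow_mem hz n
  have hcomm : z ^ n * e = e * z ^ n := ((Subalgebra.mem_center_iff.1 hzn) e).symm
  -- `z ^ n * e` is a central idempotent below `e`, nonzero because its augmentation is; primitivity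
  -- leaves only `e`. As `e` acts as the identity, so does `z ^ n`.
  have hfe : z ^ n * e = e := by
    refine (he.primitive (z ^ n * e) (mul_mem hzn he.central) ?_ ?_).resolve_left ?_
    · rw [IsIdempotentElem, mul_assoc, ← mul_assoc e, ← hcomm, mul_assoc, ← mul_assoc,
        he.idem, hI]
    · rw [mul_assoc, he.idem]
    · intro h0
      have := congrArg (augmentation k G) h0
      rw [map_mul, map_pow, het, map_zero, mul_one] at this
      exact hza (pow_eq_zero_iff hn |>.1 this)
  have hone : ρ.asAlgebraHom z ^ n = 1 := by
    have := congrArg ρ.asAlgebraHom hfe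
    rwa [map_mul, show ρ.asAlgebraHom e = 1 from heV, mul_one, map_pow] at this
  intro h0
  apply hv
  have : (ρ.asAlgebraHom z ^ n) v = 0 := by
    obtain ⟨m, rfl⟩ := Nat.exists_eq_succ_of_ne_zero hn
    rw [pow_succ, Module.End.mul_apply, h0, map_zero]
  rwa [hone] at this

/-- The principal block idempotent is central of augmentation one, so under this hypothesis it acts
as the identity. -/
lemma InPrincipalBlock.of_central [Finite k] [Finite G] {ρ : Representation k G V}
    (h : ∀ z ∈ Subalgebra.center k (MonoidAlgebra k G), ∀ v,
      ρ.asAlgebraHom z v = augmentation k G z • v) : InPrincipalBlock ρ := by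
  obtain ⟨e, he, het⟩ := exists_principal_isBlockIdempotent k G
  refine ⟨e, he, het, ?_⟩
  ext v
  rw [h e he.central, (belongsToBlock_trivial_iff e).1 het, one_smul]
  rfl

lemma coeff_conj_of_mem_center {z : MonoidAlgebra k G}
    (hz : z ∈ Subalgebra.center k (MonoidAlgebra k G)) (g h : G) :
    z.coeff (h * g * h⁻¹) = z.coeff g := by
  have := congrArg (fun a => a.coeff (h * g))
    ((Subalgebra.mem_center_iff.1 hz) (MonoidAlgebra.single h 1))
  simpa [MonoidAlgebra.coeff_single_mul_apply, MonoidAlgebra.coeff_mul_single_apply] using this.symm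

end ModularRep

/-! ### Rank one data and permutation modules. -/

namespace ModularRep

open MulAction

/-- Data on a finite group `G` acting on `X` modelled on a split BN-pair of rank one: the stabilizer
of a point is an extension of a cyclic `p`-group, split by an element `s`, by a subgroup that is
transitive on the other points and whose order is prime to `p`, and `s` is inverted by an element
that moves the base point. -/
structure IsRankOneData (p n : ℕ) {G X : Type*} [Group G] [MulAction G X] (x₀ : X) (s w : G)
    (π : stabilizer G x₀ →* Multiplicative (ZMod (p ^ n))) : Prop where
  pos : n ≠ 0
  odd : p ≠ 2
  smul_s : s • x₀ = x₀
  s_pow : s ^ p ^ n = 1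
  map_s : π ⟨s, smul_s⟩ = Multiplicative.ofAdd 1
  conj : w * s * w⁻¹ = s⁻¹
  smul_w : w • x₀ ≠ x₀
  transitive : ∀ y, y ≠ x₀ → ∃ h ∈ π.ker, (h : G) • w • x₀ = y
  card_ker : ¬ p ∣ Nat.card π.ker
  card_points : (Nat.card X : ZMod p) = 2

namespace IsRankOneData

variable {p n : ℕ} {G X : Type*} [Group G] [MulAction G X] {x₀ : X} {s w : G}
  {π : stabilizer G x₀ →* Multiplicative (ZMod (p ^ n))}

lemma exists_smul_eq (D : IsRankOneData p n x₀ s w π) (x : X) : ∃ g : G, g • x₀ = x := by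
  by_cases hx : x = x₀
  · exact ⟨1, by simp [hx]⟩
  · obtain ⟨h, -, hh⟩ := D.transitive x hx
    exact ⟨h * w, by rw [mul_smul, hh]⟩

/-- An element of `G` carrying the base point to a given point. -/
def rep (D : IsRankOneData p n x₀ s w π) (x : X) : G := (D.exists_smul_eq x).choose

@[simp]
lemma rep_smul (D : IsRankOneData p n x₀ s w π) (x : X) : D.rep x • x₀ = x :=
  (D.exists_smul_eq x).choose_spec

/-- The element `s` of the stabilizer of the base point. -/
def sStab (D : IsRankOneData p n x₀ s w π) : stabilizer G x₀ := ⟨s, D.smul_s⟩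

lemma map_sStab (D : IsRankOneData p n x₀ s w π) : π D.sStab = Multiplicative.ofAdd 1 := D.map_s

lemma sStab_pow (D : IsRankOneData p n x₀ s w π) : D.sStab ^ p ^ n = 1 :=
  Subtype.ext D.s_pow

lemma exists_eq_mul_pow [Fact p.Prime] (D : IsRankOneData p n x₀ s w π) (b : stabilizer G x₀) :
    ∃ h ∈ π.ker, ∃ i : ℕ, b = h * D.sStab ^ i := by
  have : NeZero (p ^ n) := ⟨pow_ne_zero _ (Fact.out : p.Prime).ne_zero⟩
  refine ⟨b * (D.sStab ^ (Multiplicative.toAdd (π b)).val)⁻¹, ?_,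
    (Multiplicative.toAdd (π b)).val, by simp⟩
  rw [MonoidHom.mem_ker, map_mul, map_inv, map_pow, map_sStab, ← ofAdd_nsmul]
  simp

lemma two_ne_zero [hp : Fact p.Prime] (D : IsRankOneData p n x₀ s w π) : (2 : ZMod p) ≠ 0 := by
  have h : ((2 : ℕ) : ZMod p) ≠ 0 := by
    rw [Ne, ZMod.natCast_eq_zero_iff]
    intro h
    exact D.odd ((Nat.prime_dvd_prime_iff_eq hp.out Nat.prime_two).1 h)
  exact_mod_cast h

/-- If `s` commuted with `g`, then `w⁻¹ * g`, an element of the stabilizer, would conjugate `s` to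
`s⁻¹`. The target of `π` is abelian, so `2 = 0` in `ZMod (p ^ n)`, impossible for `p` odd and `n ≠
0`. -/
lemma conj_ne [hp : Fact p.Prime] (D : IsRankOneData p n x₀ s w π) {g : G}
    (hg : g • x₀ = w • x₀) : s * g * s⁻¹ ≠ g := by
  intro hc
  have hb : w⁻¹ * g ∈ stabilizer G x₀ := by
    rw [mem_stabilizer_iff, mul_smul, hg, inv_smul_smul]
  have hws : w⁻¹ * s * w = s⁻¹ := by
    have := D.conj
    rw [← inv_inj, inv_inv] at this
    rw [← this]
    nth_rewrite 1 [← this]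
    group
  have key : (⟨_, hb⟩ : stabilizer G x₀) * D.sStab * (⟨_, hb⟩ : stabilizer G x₀)⁻¹
      = D.sStab⁻¹ := by
    apply Subtype.ext
    change w⁻¹ * g * s * (w⁻¹ * g)⁻¹ = s⁻¹
    rw [← hws]
    have : g * s * g⁻¹ = s := by
      nth_rewrite 1 [← hc]
      group
    calc w⁻¹ * g * s * (w⁻¹ * g)⁻¹ = w⁻¹ * (g * s * g⁻¹) * w := by group
      _ = _ := by rw [this]
  have := congrArg π key
  rw [map_mul, map_mul, map_inv, map_inv, mul_right_comm, mul_inv_cancel, one_mul, map_sStab,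
    ← ofAdd_neg, Multiplicative.ofAdd.injective.eq_iff, eq_neg_iff_add_eq_zero] at this
  have h2 : ((2 : ℕ) : ZMod (p ^ n)) = 0 := by
    push_cast
    rw [← this]
    norm_num
  rw [ZMod.natCast_eq_zero_iff] at h2
  exact D.odd ((Nat.prime_dvd_prime_iff_eq hp.out Nat.prime_two).1
    ((dvd_pow_self p D.pos).trans h2))

end IsRankOneData

/-- An intertwining map is linear over the group algebra. -/
lemma map_asAlgebraHom {k G V W : Type*} [CommSemiring k] [Group G] [AddCommMonoid V] [Module k V]
    [AddCommMonoid W] [Module k W] {ρ : Representation k G V} {σ : Representation k G W}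
    (f : ρ.IntertwiningMap σ) (a : MonoidAlgebra k G) (v : V) :
    f (ρ.asAlgebraHom a v) = σ.asAlgebraHom a (f v) := by
  induction a using MonoidAlgebra.induction_linear with
  | zero => simp
  | add x y hx hy => simp [hx, hy]
  | single g r => simp [f.isIntertwining]

section Permutation

variable (k : Type*) [Field k] (G : Type*) [Group G] (X : Type*) [MulAction G X]

/-- The sum of the coefficients, as a map from a permutation module to the trivial module. -/
def coeffSum : (Representation.ofMulAction k G X).IntertwiningMap
    (Representation.trivial k G k) where
  toLinearMap := (Finsupp.linearCombination k fun _ : X => (1 : k)) ∘ₗ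
    (MonoidAlgebra.coeffLinearEquiv k).toLinearMap
  isIntertwining' g := by
    ext
    simp

variable {k G X}

@[simp]
lemma coeffSum_single (x : X) (c : k) : coeffSum k G X (MonoidAlgebra.single x c) = c := by
  change (Finsupp.linearCombination k fun _ : X => (1 : k)) (Finsupp.single x c) = c
  simp

lemma coeffSum_eq_sum [Fintype X] (v : MonoidAlgebra k X) :
    coeffSum k G X v = ∑ x, v.coeff x := by
  change (Finsupp.linearCombination k fun _ : X => (1 : k)) v.coeff = _
  rw [Finsupp.linearCombination_apply, Finsupp.sum_fintype _ _ (by simp)]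
  simp

lemma eq_sum_single [Fintype X] (v : MonoidAlgebra k X) :
    v = ∑ x, v.coeff x • MonoidAlgebra.single x (1 : k) := by
  classical
  ext x
  simp [MonoidAlgebra.coeff_sum]

variable (k X) in
/-- The sum of all points in a permutation module. -/
def allSum [Fintype X] : MonoidAlgebra k X := ∑ x, MonoidAlgebra.single x 1

@[simp]
lemma allSum_coeff [Fintype X] (x : X) : (allSum k X).coeff x = 1 := by
  classical
  simp [allSum, MonoidAlgebra.coeff_sum, Finsupp.single_apply]

lemma coeffSum_allSum [Fintype X] : coeffSum k G X (allSum k X) = Nat.card X := by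
  simp [coeffSum_eq_sum]

lemma ofMulAction_allSum [Fintype X] (g : G) :
    Representation.ofMulAction k G X g (allSum k X) = allSum k X := by
  ext x
  simp

end Permutation

end ModularRep

/-! ### The block and the submodules of the permutation module. -/

namespace ModularRep

open MulAction

/-- A function invariant under a permutation of `p`-power order without fixed points has sum zero
modulo `p`. -/
lemma sum_eq_zero_of_perm {p n : ℕ} [Fact p.Prime] {α : Type*} [Fintype α] (σ : Equiv.Perm α)
    (hσ : σ ^ p ^ n = 1) (hfix : ∀ a, σ a ≠ a) (f : α → ZMod p) (hf : ∀ a, f (σ a) = f a) :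
    ∑ a, f a = 0 := by
  classical
  rw [← Finset.sum_fiberwise (s := Finset.univ) (g := f)]
  refine Finset.sum_eq_zero fun c _ => ?_
  rw [Finset.sum_congr rfl (g := fun _ => c) (fun a ha => (Finset.mem_filter.1 ha).2),
    Finset.sum_const, nsmul_eq_mul]
  -- `σ` preserves each fibre of `f`, and the size of a fibre is congruent modulo `p` to its number
  -- of fixed points, which is zero.
  have hcard : ((Fintype.card {a // f a = c} : ℕ) : ZMod p) = 0 := by
    let τ : Equiv.Perm {a // f a = c} := σ.subtypePerm fun a => by rw [hf a]
    have h1 : τ ^ p ^ n = 1 := by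
      rw [Equiv.Perm.subtypePerm_pow]
      ext a
      simp [hσ]
    have hmod := Equiv.Perm.card_compl_support_modEq (p := p) (n := n) h1
    have hz : τ.supportᶜ = ∅ := by
      rw [Finset.compl_eq_empty_iff, Finset.eq_univ_iff_forall]
      intro a
      rw [Equiv.Perm.mem_support]
      exact fun h => hfix a.1 (congrArg Subtype.val h)
    rw [hz, Finset.card_empty] at hmod
    exact ((ZMod.natCast_eq_natCast_iff _ _ _).2 hmod).symm.trans (by simp)
  rw [Fintype.card_subtype] at hcard
  rw [hcard, zero_mul]

namespace IsRankOneData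

variable {p n : ℕ} [Fact p.Prime] {G X : Type*} [Group G] [Finite G] [MulAction G X] [Finite X]
  {x₀ : X} {s w : G} {π : stabilizer G x₀ →* Multiplicative (ZMod (p ^ n))}

-- This sum is the coefficient at `w • x₀` of `z` applied to the base point. Since `s` fixes both
-- points, conjugation by `s` permutes the summation range; it has no fixed point by `conj_ne`, and
-- it preserves the coefficients of a central element.
omit [Finite G] [Finite X] in
lemma sum_coeff_eq_zero [Fintype G] [DecidableEq X] (D : IsRankOneData p n x₀ s w π)
    {z : MonoidAlgebra (ZMod p) G}
    (hz : z ∈ Subalgebra.center (ZMod p) (MonoidAlgebra (ZMod p) G)) :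
    ∑ g with g • x₀ = w • x₀, z.coeff g = 0 := by
  have hsw : s • w • x₀ = w • x₀ := by
    have h : s = w * s⁻¹ * w⁻¹ := by
      simpa [mul_assoc] using congrArg (·⁻¹) D.conj.symm
    nth_rewrite 1 [h]
    rw [mul_smul, mul_smul, inv_smul_smul, inv_smul_eq_iff.2 D.smul_s.symm]
  have hmem : ∀ g : G, g • x₀ = w • x₀ ↔ MulAut.conj s g • x₀ = w • x₀ := by
    intro g
    rw [MulAut.conj_apply, mul_smul, mul_smul, inv_smul_eq_iff.2 D.smul_s.symm]
    nth_rewrite 2 [← hsw]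
    exact smul_left_cancel_iff s |>.symm
  let σ : Equiv.Perm {g : G // g • x₀ = w • x₀} := 
    Equiv.Perm.subtypePerm (MulAut.conj s).toEquiv fun g => (hmem g).symm
  have hσ : σ ^ p ^ n = 1 := by
    have h : ∀ m : ℕ, ∀ a, ((σ ^ m) a : G) = s ^ m * a * (s ^ m)⁻¹ := by
      intro m
      induction m with
      | zero => simp
      | succ m ih =>
        intro a
        rw [pow_succ', Equiv.Perm.mul_apply]
        change s * ((σ ^ m) a : G) * s⁻¹ = _
        rw [ih, pow_succ']
        group
    ext a
    rw [h, D.s_pow]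
    simp
  have := sum_eq_zero_of_perm σ hσ (fun a h => D.conj_ne a.2 (congrArg Subtype.val h))
    (fun a => z.coeff a) (fun a => coeff_conj_of_mem_center hz _ _)
  rw [← this, Finset.sum_subtype]
  simp

/-- The image of the base point under `z` is fixed by the stabilizer, which is transitive on the
other points, so `sum_coeff_eq_zero` kills every coefficient except that at `x₀`. The coefficient
sum identifies the remaining scalar, and the translates of the base point span. -/
lemma center_apply (D : IsRankOneData p n x₀ s w π) {z : MonoidAlgebra (ZMod p) G}
    (hz : z ∈ Subalgebra.center (ZMod p) (MonoidAlgebra (ZMod p) G))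
    (v : MonoidAlgebra (ZMod p) X) :
    (Representation.ofMulAction (ZMod p) G X).asAlgebraHom z v
      = augmentation (ZMod p) G z • v := by
  classical
  have := Fintype.ofFinite G
  have := Fintype.ofFinite X
  set ρ := Representation.ofMulAction (ZMod p) G X with hρ
  have hcomm : ∀ g v, ρ.asAlgebraHom z (ρ g v) = ρ g (ρ.asAlgebraHom z v) := by
    intro g v
    rw [← Representation.asAlgebraHom_single_one, ← Module.End.mul_apply, ← Module.End.mul_apply,
      ← map_mul, ← map_mul, (Subalgebra.mem_center_iff.1 hz)]
  set u := ρ.asAlgebraHom z (MonoidAlgebra.single x₀ 1) with hu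
  have hcoeff : ∀ y, u.coeff y = ∑ g with g • x₀ = y, z.coeff g := by
    intro y
    rw [hu, eq_sum_single z, map_sum, LinearMap.sum_apply, MonoidAlgebra.coeff_sum,
      Finset.sum_filter]
    simp [hρ, Finsupp.single_apply, MonoidAlgebra.coeff_sum]
  have hfix : ∀ g : G, g • x₀ = x₀ → ρ g u = u := by
    intro g hg
    rw [hu, ← hcomm, hρ, Representation.ofMulAction_single, hg]
  have hzero : ∀ y, y ≠ x₀ → u.coeff y = 0 := by
    intro y hy
    obtain ⟨h, -, rfl⟩ := D.transitive y hy
    rw [← hfix h h.2, hρ, Representation.coeff_ofMulAction, inv_smul_smul, hcoeff]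
    exact D.sum_coeff_eq_zero hz
  have hu' : u = augmentation (ZMod p) G z • MonoidAlgebra.single x₀ 1 := by
    have hs : coeffSum (ZMod p) G X u = augmentation (ZMod p) G z := by
      rw [hu, map_asAlgebraHom, asAlgebraHom_trivial]
      simp
    have h0 : u.coeff x₀ = augmentation (ZMod p) G z := by
      rw [← hs, coeffSum_eq_sum]
      exact (Finset.sum_eq_single x₀ (fun y _ hy => hzero y hy) (by simp)).symm
    ext y
    by_cases hy : y = x₀
    · simp [hy, h0]
    · rw [hzero y hy]
      simp [Ne.symm hy]
  induction v using MonoidAlgebra.induction_linear with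
  | zero => simp
  | add x y hx hy => rw [map_add, hx, hy, smul_add]
  | single x c =>
    have : (MonoidAlgebra.single x c : MonoidAlgebra (ZMod p) X)
        = c • ρ (D.rep x) (MonoidAlgebra.single x₀ 1) := by simp [hρ]
    rw [this, map_smul, hcomm, ← hu, hu', map_smul, smul_comm]

/-- A submodule of the permutation module that contains a nonzero vector of coefficient sum zero
contains all of them. -/
lemma mem_of_coeffSum_eq_zero (D : IsRankOneData p n x₀ s w π)
    (W : Submodule (ZMod p) (MonoidAlgebra (ZMod p) X))
    (hW : ∀ g, ∀ v ∈ W, Representation.ofMulAction (ZMod p) G X g v ∈ W)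
    {v : MonoidAlgebra (ZMod p) X} (hv : v ∈ W) (hv0 : v ≠ 0)
    (hvs : coeffSum (ZMod p) G X v = 0)
    {u : MonoidAlgebra (ZMod p) X} (hu : coeffSum (ZMod p) G X u = 0) : u ∈ W := by
  classical
  have := Fintype.ofFinite G
  have := Fintype.ofFinite X
  set ρ := Representation.ofMulAction (ZMod p) G X with hρ
  obtain ⟨x, hx⟩ : ∃ x, v.coeff x ≠ 0 := by
    by_contra! h
    exact hv0 (by ext x; simpa using h x)
  set v₁ := ρ (D.rep x)⁻¹ v with hv₁
  have hv₁x : v₁.coeff x₀ ≠ 0 := by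
    rw [hv₁, hρ, Representation.coeff_ofMulAction, inv_inv, D.rep_smul]
    exact hx
  have hv₁s : coeffSum (ZMod p) G X v₁ = 0 := by
    rw [hv₁, (coeffSum (ZMod p) G X).isIntertwining, hvs, map_zero]
  -- Summing over `π.ker` makes the vector constant off `x₀`, by transitivity, and multiplies its
  -- coefficient at `x₀` by `|π.ker|`, which is prime to `p`.
  set m := ∑ h : π.ker, ρ (h : stabilizer G x₀) v₁ with hm
  have hmW : m ∈ W := sum_mem fun h _ => hW _ _ (hW _ _ hv)
  have hms : coeffSum (ZMod p) G X m = 0 := by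
    rw [hm, map_sum]
    refine Finset.sum_eq_zero fun h _ => ?_
    rw [(coeffSum (ZMod p) G X).isIntertwining, hv₁s, map_zero]
  have hm0 : m.coeff x₀ ≠ 0 := by
    have : ∀ h : π.ker, (((h : stabilizer G x₀) : G)⁻¹) • x₀ = x₀ := fun h =>
      inv_smul_eq_iff.2 h.1.2.symm
    rw [hm, MonoidAlgebra.coeff_sum, Finsupp.finsetSum_apply]
    simp only [hρ, Representation.coeff_ofMulAction, this, Finset.sum_const, nsmul_eq_mul,
      Finset.card_univ]
    refine mul_ne_zero ?_ hv₁x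
    rw [Ne, ZMod.natCast_eq_zero_iff, ← Nat.card_eq_fintype_card]
    exact D.card_ker
  have hmH : ∀ h ∈ π.ker, ρ ((h : stabilizer G x₀) : G) m = m := by
    intro h hh
    rw [hm, map_sum]
    refine Fintype.sum_equiv (Equiv.mulLeft (⟨h, hh⟩ : π.ker)) _ _ fun a => ?_
    simp
  set d := m.coeff (w • x₀) with hd
  have hmd : ∀ y, y ≠ x₀ → m.coeff y = d := by
    intro y hy
    obtain ⟨h, hh, rfl⟩ := D.transitive y hy
    rw [← hmH h hh, hρ, Representation.coeff_ofMulAction, inv_smul_smul]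
  -- There are `|X| - 1` points other than `x₀`, and this number is `1` in `ZMod p`.
  have hcd : m.coeff x₀ + d = 0 := by
    rw [coeffSum_eq_sum, ← Finset.add_sum_erase _ _ (Finset.mem_univ x₀),
      Finset.sum_congr rfl (g := fun _ => d) (fun y hy => hmd y (Finset.ne_of_mem_erase hy)),
      Finset.sum_const, Finset.card_erase_of_mem (Finset.mem_univ _), nsmul_eq_mul,
      Nat.cast_sub (Finset.card_pos.2 ⟨x₀, Finset.mem_univ _⟩), Finset.card_univ,
      ← Nat.card_eq_fintype_card, D.card_points] at hms
    linear_combination hms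
  have hdiff : ∀ y, MonoidAlgebra.single y 1 - MonoidAlgebra.single x₀ 1 ∈ W := by
    intro y
    by_cases hy : y = x₀
    · simp [hy]
    have h1 : ρ (D.rep y) m - m ∈ W := sub_mem (hW _ _ hmW) hmW
    have hc : (2 * m.coeff x₀) ≠ 0 := mul_ne_zero D.two_ne_zero hm0
    -- The translate differs from `m` only at `x₀` and `y`, by the scalar `m.coeff x₀ - d`, which
    -- equals `2 * m.coeff x₀` by `hcd`.
    have h2 : ρ (D.rep y) m - m
        = (2 * m.coeff x₀) • (MonoidAlgebra.single y 1 - MonoidAlgebra.single x₀ 1) := by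
      ext t
      have hsm : (D.rep y)⁻¹ • t = x₀ ↔ y = t := by
        rw [inv_smul_eq_iff, D.rep_smul, eq_comm]
      simp only [MonoidAlgebra.coeff_sub, Finsupp.sub_apply, hρ, Representation.coeff_ofMulAction,
        MonoidAlgebra.coeff_smul, Finsupp.smul_apply, MonoidAlgebra.coeff_single,
        Finsupp.single_apply, smul_eq_mul]
      by_cases h1 : y = t
      · have h2 : t ≠ x₀ := h1 ▸ hy
        rw [hsm.2 h1, hmd t h2, if_pos h1, if_neg h2.symm]
        linear_combination -hcd
      · rw [hmd _ (fun h => h1 (hsm.1 h)), if_neg h1]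
        by_cases h2 : x₀ = t
        · rw [← h2, if_pos rfl]
          linear_combination hcd
        · rw [hmd t (Ne.symm h2), if_neg h2]
          ring
    rw [h2] at h1
    exact (W.smul_mem_iff hc).1 h1
  have hsum : u = ∑ y, u.coeff y • (MonoidAlgebra.single y (1 : ZMod p)
      - MonoidAlgebra.single x₀ 1) := by
    simp only [smul_sub, Finset.sum_sub_distrib]
    rw [← eq_sum_single, ← Finset.sum_smul, ← coeffSum_eq_sum (G := G), hu, zero_smul, sub_zero]
  rw [hsum]
  exact sum_mem fun y _ => W.smul_mem _ (hdiff y)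

end IsRankOneData

end ModularRep

/-! ### Vectors fixed by the point stabilizer. -/

namespace ModularRep

open MulAction

namespace IsRankOneData

section Fixed

variable {p n : ℕ} [Fact p.Prime] {G X : Type*} [Group G] [MulAction G X]
  {x₀ : X} {s w : G} {π : stabilizer G x₀ →* Multiplicative (ZMod (p ^ n))}

variable (p) in
/-- The sum in the group algebra of the elements of a conjugate of the kernel of `π`. -/
def conjKerSum [Finite G] (π : stabilizer G x₀ →* Multiplicative (ZMod (p ^ n))) (g : G) :
    MonoidAlgebra (ZMod p) G :=
  haveI := Fintype.ofFinite π.ker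
  ∑ h : π.ker, MonoidAlgebra.single (g * ((h : stabilizer G x₀) : G) * g⁻¹) 1

lemma conjKerSum_mul [Finite G] (g : G) (b : stabilizer G x₀) :
    conjKerSum p π (g * b) = conjKerSum p π g := by
  let := Fintype.ofFinite π.ker
  rw [conjKerSum, conjKerSum]
  refine Fintype.sum_equiv (MulAut.conjNormal b : π.ker ≃* π.ker).toEquiv _ _ fun h => ?_
  congr 1
  simp only [MulEquiv.toEquiv_eq_coe, EquivLike.coe_coe, MulAut.conjNormal_apply,
    Subgroup.coe_mul, Subgroup.coe_inv, mul_inv_rev]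
  group

lemma single_mul_conjKerSum [Finite G] (a g : G) :
    MonoidAlgebra.single a 1 * conjKerSum p π g
      = conjKerSum p π (a * g) * MonoidAlgebra.single a 1 := by
  rw [conjKerSum, conjKerSum, Finset.mul_sum, Finset.sum_mul]
  refine Finset.sum_congr rfl fun h _ => ?_
  simp only [MonoidAlgebra.single_mul_single, mul_one]
  congr 1
  group

/-- `π.ker` is normal in the stabilizer, so its conjugates are attached to points. Hence `G`
permutes the conjugate sums as it permutes `X`, and their total is central. -/
lemma conjKerSum_eq [Finite G] {g g' : G} (h : g • x₀ = g' • x₀) :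
    conjKerSum p π g = conjKerSum p π g' := by
  have hb : g'⁻¹ * g ∈ stabilizer G x₀ := by
    rw [mem_stabilizer_iff, mul_smul, h, inv_smul_smul]
  rw [← conjKerSum_mul g' ⟨_, hb⟩]
  simp

lemma sum_conjKerSum_mem_center [Finite G] [Fintype X] (D : IsRankOneData p n x₀ s w π) :
    ∑ x, conjKerSum p π (D.rep x) ∈
      Subalgebra.center (ZMod p) (MonoidAlgebra (ZMod p) G) := by
  rw [Subalgebra.mem_center_iff]
  intro b
  induction b using MonoidAlgebra.induction_linear with
  | zero => simp
  | add x y hx hy => rw [add_mul, mul_add, hx, hy]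
  | single a c =>
    have hc : (MonoidAlgebra.single a c : MonoidAlgebra (ZMod p) G)
        = c • MonoidAlgebra.single a 1 := by simp
    rw [hc, smul_mul_assoc, mul_smul_comm, Finset.mul_sum, Finset.sum_mul]
    congr 1
    refine Fintype.sum_equiv (MulAction.toPerm a) _ _ fun x => ?_
    rw [single_mul_conjKerSum]
    congr 1
    apply conjKerSum_eq
    simp [mul_smul]

lemma augmentation_sum_conjKerSum [Finite G] [Fintype X] (D : IsRankOneData p n x₀ s w π) :
    augmentation (ZMod p) G (∑ x, conjKerSum p π (D.rep x)) ≠ 0 := by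
  have : ∀ g : G, augmentation (ZMod p) G (conjKerSum p π g) = Nat.card π.ker := by
    intro g
    let := Fintype.ofFinite π.ker
    simp [conjKerSum, map_sum, Nat.card_eq_fintype_card, -MonoidHom.mem_ker]
  rw [map_sum]
  simp only [this, Finset.sum_const, Finset.card_univ, nsmul_eq_mul]
  rw [← Nat.card_eq_fintype_card, D.card_points]
  refine mul_ne_zero D.two_ne_zero ?_
  rw [Ne, ZMod.natCast_eq_zero_iff]
  exact D.card_ker

/-- A nonzero representation in the principal block has a nonzero vector fixed by the stabilizer of
the base point. -/
lemma exists_fixed [Finite G] [Finite X] (D : IsRankOneData p n x₀ s w π) {V : Type*}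
    [AddCommGroup V] [Module (ZMod p) V] {ρ : Representation (ZMod p) G V}
    (hρ : InPrincipalBlock ρ) [Nontrivial V] :
    ∃ y : V, y ≠ 0 ∧ ∀ b : stabilizer G x₀, ρ b y = y := by
  classical
  have := Fintype.ofFinite X
  obtain ⟨v, hv⟩ := exists_ne (0 : V)
  have h1 := hρ.apply_ne_zero D.sum_conjKerSum_mem_center D.augmentation_sum_conjKerSum hv
  rw [map_sum, LinearMap.sum_apply] at h1
  obtain ⟨x, -, hx⟩ := Finset.exists_ne_zero_of_sum_ne_zero h1
  set g := D.rep x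
  -- Translating by `g⁻¹` turns the sum over the conjugate of `π.ker` into a sum over `π.ker`
  -- itself, so `u` is fixed by `π.ker`.
  set u := ρ g⁻¹ (ρ.asAlgebraHom (conjKerSum p π g) v) with hu
  have hu0 : u ≠ 0 := fun h => hx (by
    have := congrArg (ρ g) h
    rwa [hu, map_zero, ρ.self_inv_apply] at this)
  have huH : ∀ h ∈ π.ker, ρ ((h : stabilizer G x₀) : G) u = u := by
    intro h hh
    let := Fintype.ofFinite π.ker
    rw [hu, conjKerSum, map_sum, LinearMap.sum_apply, map_sum, map_sum]
    refine Fintype.sum_equiv (Equiv.mulLeft (⟨h, hh⟩ : π.ker)) _ _ fun a => ?_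
    simp only [Representation.asAlgebraHom_single_one, ← Module.End.mul_apply, ← map_mul]
    congr 2
    simp only [Equiv.coe_mulLeft, Subgroup.coe_mul]
    group
  -- In characteristic `p`, `N ^ p ^ n` is `ρ (s ^ p ^ n) - 1 = 0`. The last nonzero `N ^ j u` is
  -- fixed by `s`, and it stays fixed by `π.ker` because `s` normalizes `π.ker`.
  let N : Module.End (ZMod p) V := ρ s - 1
  have hN : N ^ p ^ n = 0 := by
    have : CharP (Module.End (ZMod p) V) p := charP_of_injective_algebraMap
      (FaithfulSMul.algebraMap_injective (ZMod p) (Module.End (ZMod p) V)) p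
    rw [sub_pow_char_pow_of_commute _ _ (Commute.one_right _), ← map_pow, D.s_pow]
    simp
  have hNH : ∀ j, ∀ h ∈ π.ker, ρ ((h : stabilizer G x₀) : G) ((N ^ j) u) = (N ^ j) u := by
    intro j
    induction j with
    | zero => simpa using huH
    | succ j ih =>
      intro h hh
      rw [pow_succ', Module.End.mul_apply]
      set t := (N ^ j) u
      have hc : D.sStab⁻¹ * h * D.sStab ∈ π.ker := by
        have := (inferInstance : π.ker.Normal).conj_mem h hh D.sStab⁻¹
        simpa using this
      have h2 : ρ (h : G) (ρ s t) = ρ s t := by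
        have h3 : (h : G) * s = s * ((D.sStab⁻¹ * h * D.sStab : stabilizer G x₀) : G) := by
          change (h : G) * s = s * (s⁻¹ * h * s)
          group
        rw [← Module.End.mul_apply, ← map_mul, h3, map_mul, Module.End.mul_apply, ih _ hc]
      change ρ (h : G) (ρ s t - t) = ρ s t - t
      rw [map_sub, h2, ih h hh]
  have hex : ∃ j, (N ^ j) u = 0 := ⟨p ^ n, by rw [hN]; rfl⟩
  obtain ⟨j, hj⟩ : ∃ j, Nat.find hex = j + 1 := Nat.exists_eq_succ_of_ne_zero fun h => by
    have := Nat.find_spec hex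
    rw [h] at this
    exact hu0 this
  refine ⟨(N ^ j) u, Nat.find_min hex (by omega), fun b => ?_⟩
  have hs : ρ s ((N ^ j) u) = (N ^ j) u := by
    have := Nat.find_spec hex
    rw [hj, pow_succ', Module.End.mul_apply] at this
    exact sub_eq_zero.1 this
  obtain ⟨h, hh, i, rfl⟩ := D.exists_eq_mul_pow b
  have hsi : ∀ i : ℕ, ρ (s ^ i) ((N ^ j) u) = (N ^ j) u := by
    intro i
    induction i with
    | zero => simp
    | succ i ih => rw [pow_succ, map_mul, Module.End.mul_apply, hs, ih]
  change ρ ((h : G) * s ^ i) _ = _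
  rw [map_mul, Module.End.mul_apply, hsi, hNH j h hh]

end Fixed

end IsRankOneData

end ModularRep

/-! ### Decomposition of the permutation module and existence of the irreducible module. -/

namespace ModularRep

open MulAction

/-- The invariants form a subrepresentation, and it cannot be everything when the action is
nontrivial. -/
lemma eq_zero_of_fixed {k G V : Type*} [Field k] [Group G] [AddCommGroup V] [Module k V]
    {ρ : Representation k G V} (hirr : ρ.IsIrreducible) (hnt : ¬ ρ.IsTrivial) {v : V}
    (hv : ∀ g, ρ g v = v) : v = 0 := by
  let I : Subrepresentation ρ :=
    { toSubmodule := ρ.invariants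
      apply_mem_toSubmodule := fun g v hv => by rw [hv g]; exact hv }
  rcases hirr.eq_bot_or_eq_top I with h | h
  · have : v ∈ I := hv
    rw [h] at this
    exact this
  · exfalso
    refine hnt ⟨fun g => LinearMap.ext fun u => ?_⟩
    have : u ∈ I := by rw [h]; trivial
    exact this g

namespace IsRankOneData

variable {p n : ℕ} [Fact p.Prime] {G X : Type*} [Group G] [MulAction G X]
  {x₀ : X} {s w : G} {π : stabilizer G x₀ →* Multiplicative (ZMod (p ^ n))}

/-- The map out of the permutation module given by a vector fixed by the point stabilizer. -/
def ofFixed (D : IsRankOneData p n x₀ s w π) {V : Type*} [AddCommGroup V] [Module (ZMod p) V]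
    (ρ : Representation (ZMod p) G V) (y : V) (hy : ∀ b : stabilizer G x₀, ρ b y = y) :
    (Representation.ofMulAction (ZMod p) G X).IntertwiningMap ρ where
  toLinearMap := (Finsupp.linearCombination (ZMod p) fun x : X => ρ (D.rep x) y) ∘ₗ
    (MonoidAlgebra.coeffLinearEquiv (ZMod p)).toLinearMap
  isIntertwining' g := by
    ext x
    have hb : (D.rep (g • x))⁻¹ * (g * D.rep x) ∈ stabilizer G x₀ := by
      rw [mem_stabilizer_iff, mul_smul, mul_smul, D.rep_smul, inv_smul_eq_iff, D.rep_smul]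
    have := congrArg (ρ (D.rep (g • x))) (hy ⟨_, hb⟩)
    rw [← Module.End.mul_apply, ← map_mul, mul_inv_cancel_left, map_mul] at this
    simp [← this]

lemma ofFixed_single (D : IsRankOneData p n x₀ s w π) {V : Type*} [AddCommGroup V]
    [Module (ZMod p) V] (ρ : Representation (ZMod p) G V) (y : V)
    (hy : ∀ b : stabilizer G x₀, ρ b y = y) :
    D.ofFixed ρ y hy (MonoidAlgebra.single x₀ 1) = y := by
  change (Finsupp.linearCombination (ZMod p) fun x : X => ρ (D.rep x) y) (Finsupp.single x₀ 1) = y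
  rw [Finsupp.linearCombination_single, one_smul]
  exact hy ⟨D.rep x₀, D.rep_smul x₀⟩

variable [Finite G] [Finite X]

/-- The permutation module is the sum of the trivial module and of any nonprincipal irreducible
representation in the principal block. -/
lemma nonempty_equiv (D : IsRankOneData p n x₀ s w π) {V : Type*} [AddCommGroup V]
    [Module (ZMod p) V] {ρ : Representation (ZMod p) G V}
    (hρ : IsNonprincipalIrreducibleInPrincipalBlock ρ) :
    Nonempty ((Representation.ofMulAction (ZMod p) G X).Equiv
      ((Representation.trivial (ZMod p) G (ZMod p)).prod ρ)) := by
  have := Fintype.ofFinite X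
  have hirr := hρ.irreducible
  have : Nontrivial V := by
    by_contra h
    rw [not_nontrivial_iff_subsingleton] at h
    exact hρ.nonprincipal ⟨fun g => Subsingleton.elim _ _⟩
  obtain ⟨y, hy0, hy⟩ := D.exists_fixed hρ.principalBlock
  set φ := D.ofFixed ρ y hy with hφ
  have hφy : φ (MonoidAlgebra.single x₀ 1) = y := D.ofFixed_single ρ y hy
  have hall : φ (allSum (ZMod p) X) = 0 := eq_zero_of_fixed hirr hρ.nonprincipal fun g => by
    rw [← φ.isIntertwining, ofMulAction_allSum]
  have hsurj : Function.Surjective φ :=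
    (Representation.IsIrreducible.surjective_or_eq_zero φ).resolve_right fun h => by
      rw [h] at hφy
      exact hy0 hφy.symm
  have hcall : coeffSum (ZMod p) G X (allSum (ZMod p) X) = 2 := by
    rw [coeffSum_allSum, D.card_points]
  have hker : ∀ v, φ v = 0 → coeffSum (ZMod p) G X v = 0 → v = 0 := by
    intro v hv hvs
    by_contra hv0
    -- This vector has sum `2 - |X| = 0` but is sent by `φ` to `2 • y ≠ 0`, so the kernel of `φ`
    -- cannot contain all vectors of sum zero, hence contains no nonzero one.
    have h2 : coeffSum (ZMod p) G X
        ((2 : ZMod p) • MonoidAlgebra.single x₀ 1 - allSum (ZMod p) X) = 0 := by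
      rw [map_sub, map_smul, coeffSum_single, hcall]
      simp
    have := D.mem_of_coeffSum_eq_zero (LinearMap.ker φ.toLinearMap)
      (fun g u hu => φ.ker.apply_mem_toSubmodule g hu) hv hv0 hvs h2
    have h3 : φ ((2 : ZMod p) • MonoidAlgebra.single x₀ 1 - allSum (ZMod p) X) = 0 := this
    rw [map_sub, map_smul, hφy, hall, sub_zero] at h3
    exact (smul_ne_zero D.two_ne_zero hy0) h3
  let Φ := (coeffSum (ZMod p) G X).prod φ
  refine ⟨Φ.ofBijective ⟨?_, ?_⟩⟩
  · rw [injective_iff_map_eq_zero]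
    intro v hv
    exact hker v (congrArg Prod.snd hv) (congrArg Prod.fst hv)
  · rintro ⟨c, v⟩
    obtain ⟨u, rfl⟩ := hsurj v
    -- `allSum` has coefficient sum `2` and is killed by `φ`, so a multiple of it adjusts the first
    -- coordinate alone.
    refine ⟨u + ((c - coeffSum (ZMod p) G X u) / 2) • allSum (ZMod p) X, Prod.ext ?_ ?_⟩
    · change coeffSum (ZMod p) G X _ = c
      rw [map_add, map_smul, hcall, smul_eq_mul, div_mul_cancel₀ _ D.two_ne_zero]
      ring
    · change φ _ = φ u
      rw [map_add, map_smul, hall, smul_zero, add_zero]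

variable (p G X) in
/-- The subrepresentation of the permutation module given by the vectors of coefficient sum zero. -/
def sumZero : Subrepresentation (Representation.ofMulAction (ZMod p) G X) :=
  (coeffSum (ZMod p) G X).ker

omit [Finite G] [Finite X] in
lemma mem_sumZero (v : MonoidAlgebra (ZMod p) X) :
    v ∈ (sumZero p G X).toSubmodule ↔ coeffSum (ZMod p) G X v = 0 := Iff.rfl

lemma sumZero_spec (D : IsRankOneData p n x₀ s w π) :
    IsNonprincipalIrreducibleInPrincipalBlock (sumZero p G X).toRepresentation := by
  have := Fintype.ofFinite X
  set d : MonoidAlgebra (ZMod p) X :=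
    MonoidAlgebra.single x₀ 1 - MonoidAlgebra.single (w • x₀) 1 with hd
  have hdmem : d ∈ (sumZero p G X).toSubmodule := by
    rw [mem_sumZero, hd, map_sub, coeffSum_single, coeffSum_single, sub_self]
  have hdc : d.coeff (w • x₀) = -1 := by simp [hd, D.smul_w.symm]
  have hd0 : d ≠ 0 := fun h => by simp [h] at hdc
  refine ⟨?_, ?_, ?_⟩
  · refine { exists_pair_ne := ⟨⊥, ⊤, fun h => ?_⟩, eq_bot_or_eq_top := fun W => ?_ }
    · have : (⟨d, hdmem⟩ : (sumZero p G X).toSubmodule) ∈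
          (⊥ : Subrepresentation (sumZero p G X).toRepresentation) := by
        rw [h]; trivial
      exact hd0 (congrArg Subtype.val this)
    · by_cases hW : ∃ v ∈ W, v ≠ 0
      · right
        obtain ⟨v, hv, hv0⟩ := hW
        rw [eq_top_iff]
        intro u _
        have := D.mem_of_coeffSum_eq_zero (W.toSubmodule.map (sumZero p G X).toSubmodule.subtype)
          (by
            rintro g _ ⟨a, ha, rfl⟩
            exact ⟨(sumZero p G X).toRepresentation g a, W.apply_mem_toSubmodule g ha, rfl⟩)
          (v := v) ⟨v, hv, rfl⟩ (fun h => hv0 (Subtype.ext h)) v.2 (u := u) u.2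
        obtain ⟨a, ha, hau⟩ := this
        rwa [← Subtype.ext hau]
      · left
        push Not at hW
        rw [eq_bot_iff]
        exact fun v hv => hW v hv
  · intro h
    -- The coefficient at `w • x₀` is `-1` in `d` and `1` in its translate by `w`; these differ as
    -- `p` is odd.
    have h1 := congrArg (fun f => ((f ⟨d, hdmem⟩ : (sumZero p G X).toSubmodule) :
      MonoidAlgebra (ZMod p) X).coeff (w • x₀)) (h.out w)
    have h2 : (Representation.ofMulAction (ZMod p) G X w d).coeff (w • x₀)
        = d.coeff (w • x₀) := h1
    rw [Representation.coeff_ofMulAction, inv_smul_smul, hdc] at h2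
    have h3 : d.coeff x₀ = 1 := by simp [hd, D.smul_w]
    rw [h3] at h2
    apply D.two_ne_zero
    linear_combination h2
  · refine InPrincipalBlock.of_central fun z hz v => Subtype.ext ?_
    let ι : (sumZero p G X).toRepresentation.IntertwiningMap
        (Representation.ofMulAction (ZMod p) G X) :=
      ⟨(sumZero p G X).toSubmodule.subtype, fun g => rfl⟩
    have := map_asAlgebraHom ι z v
    rw [D.center_apply hz] at this
    exact this

end IsRankOneData

end ModularRep

/-! ### Splitting 2-cocycles with trivial coefficients. -/

namespace ModularRep

section Cochains

variable {k G : Type*} [Field k] [Group G]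

/-- The identity satisfied by inhomogeneous 2-cocycles with trivial coefficients. -/
def IsTrivialCocycle (f : G → G → k) : Prop :=
  ∀ x y z, f (x * y) z + f x y = f y z + f x (y * z)

namespace IsTrivialCocycle

lemma one_right {f : G → G → k} (hf : IsTrivialCocycle f) (x : G) : f x 1 = f 1 1 := by
  have := hf x 1 1
  simp only [mul_one] at this
  linear_combination this

/-- A 2-cocycle that splits on a subgroup of invertible index splits. -/
lemma exists_of_subgroup {f : G → G → k} (hf : IsTrivialCocycle f) (C : Subgroup G)
    [C.FiniteIndex] (hC : (C.index : k) ≠ 0) (b : G → k)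
    (hb : ∀ x ∈ C, ∀ y ∈ C, f x y = b x + b y - b (x * y)) :
    ∃ a : G → k, ∀ x y, f x y = a x + a y - a (x * y) := by
  have : Fintype (G ⧸ C) := C.fintypeQuotientOfFiniteIndex
  let r : G → G := fun x => (x : G ⧸ C).out
  have hr : ∀ x, (r x)⁻¹ * x ∈ C := fun x => QuotientGroup.eq.1 (Quotient.out_eq' (x : G ⧸ C))
  have hrc : ∀ x, ∀ c ∈ C, r (x * c) = r x := fun x c hc => by
    change ((x * c : G) : G ⧸ C).out = _
    rw [QuotientGroup.mk_mul_of_mem x hc]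
  -- An extension of the splitting from `C` to `G`, normalized to vanish at coset representatives.
  -- Once its coboundary is subtracted, the cocycle is constant when its second argument lies in
  -- `C`, hence depends on that argument only through its coset.
  let a₁ : G → k := fun x => b ((r x)⁻¹ * x) - f (r x) ((r x)⁻¹ * x)
  have ha₁ : ∀ x, ∀ c ∈ C, f x c = a₁ x + b c - a₁ (x * c) := by
    intro x c hc
    have h1 := hf (r x) ((r x)⁻¹ * x) c
    have h2 := hb _ (hr x) c hc
    simp only [a₁, hrc x c hc]
    rw [mul_inv_cancel_left, mul_assoc] at h1
    rw [mul_assoc] at h2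
    linear_combination h1 + h2
  have hr1 : r 1 ∈ C := by simpa using inv_mem (hr 1)
  have ha₁C : ∀ c ∈ C, a₁ c = b c - b (r 1) := by
    intro c hc
    have hrc' : r c = r 1 := by simpa using hrc 1 c hc
    have := hb _ hr1 ((r 1)⁻¹ * c) (mul_mem (inv_mem hr1) hc)
    rw [mul_inv_cancel_left] at this
    simp only [a₁, hrc']
    linear_combination -this
  let f' : G → G → k := fun x y => f x y - (a₁ x + a₁ y - a₁ (x * y))
  have hf' : IsTrivialCocycle f' := by
    intro x y z
    simp only [f', mul_assoc]
    linear_combination hf x y z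
  have hf'c : ∀ x y, ∀ c ∈ C, f' x (y * c) = f' x y := by
    intro x y c hc
    have h0 : ∀ x, f' x c = b (r 1) := fun x => by
      simp only [f']
      rw [ha₁ x c hc, ha₁C c hc]
      ring
    have := hf' x y c
    rw [h0, h0] at this
    linear_combination -this
  -- Transfer: summing the cocycle identity over cosets in the third variable exhibits `C.index *
  -- f'` as the coboundary of `h`.
  let h : G → k := fun x => ∑ q : G ⧸ C, f' x q.out
  have hsum : ∀ x y, ∑ q : G ⧸ C, f' x (y * q.out) = h x := by
    intro x y
    refine Fintype.sum_equiv (MulAction.toPerm y) _ _ fun q => ?_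
    have hq : ((y * q.out : G) : G ⧸ C) = y • q := by
      conv_rhs => rw [← Quotient.out_eq' q]
      rfl
    have := hr (y * q.out)
    rw [MulAction.toPerm_apply, ← hq]
    have h2 := hf'c x (r (y * q.out)) _ this
    rw [mul_inv_cancel_left] at h2
    exact h2
  have hmain : ∀ x y, (C.index : k) * f' x y = h x + h y - h (x * y) := by
    intro x y
    have := Finset.sum_congr (rfl : (Finset.univ : Finset (G ⧸ C)) = Finset.univ)
      fun q _ => hf' x y q.out
    rw [Finset.sum_add_distrib, Finset.sum_add_distrib, hsum, Finset.sum_const, Finset.card_univ,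
      nsmul_eq_mul, ← Nat.card_eq_fintype_card, ← Subgroup.index] at this
    linear_combination this
  refine ⟨fun x => a₁ x + h x / C.index, fun x y => ?_⟩
  have := hmain x y
  simp only [f'] at this
  field_simp
  linear_combination this

/-- A 2-cocycle on a finite group splits on a cyclic subgroup when its sum along the powers of the
generator vanishes. -/
lemma exists_of_zpowers [Finite G] {f : G → G → k} (hf : IsTrivialCocycle f) (s : G)
    (hs : ∑ i ∈ Finset.range (orderOf s), f (s ^ i) s = 0) :
    ∃ b : G → k, ∀ x ∈ Subgroup.zpowers s, ∀ y ∈ Subgroup.zpowers s,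
      f x y = b x + b y - b (x * y) := by
  classical
  set N := orderOf s with hN
  -- The values at `s ^ i` forced by the splitting equation when the value at `s` is chosen to be
  -- `0`. Vanishing of the full sum makes `B` periodic modulo the order of `s`, hence well defined
  -- on powers.
  let B : ℕ → k := fun i => f 1 1 - ∑ j ∈ Finset.range i, f (s ^ j) s
  have hB1 : ∀ i, B (i + 1) = B i - f (s ^ i) s := fun i => by
    simp only [B, Finset.sum_range_succ]
    ring
  have hBN : ∀ i, B (i + N) = B i := by
    intro i
    induction i with
    | zero => simp [B, hs]
    | succ i ih =>
      rw [add_right_comm, hB1, ih, hB1, pow_add, hN, pow_orderOf_eq_one, mul_one]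
  have hBm : ∀ i m, B (i + N * m) = B i := by
    intro i m
    induction m with
    | zero => simp
    | succ m ih => rw [mul_add, mul_one, ← add_assoc, hBN, ih]
  have hBmod : ∀ i, B (i % N) = B i := fun i => by
    conv_rhs => rw [← Nat.mod_add_div i N, hBm]
  have hBeq : ∀ i j, s ^ i = s ^ j → B i = B j := by
    intro i j hij
    rw [pow_eq_pow_iff_modEq] at hij
    rw [← hBmod i, ← hBmod j, hN, hij]
  have hmain : ∀ i j, f (s ^ i) (s ^ j) = B i + B j - B (i + j) := by
    intro i j
    induction j with
    | zero => simp [hf.one_right, B]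
    | succ j ih =>
      have := hf (s ^ i) (s ^ j) s
      rw [← pow_add, ← pow_succ] at this
      rw [← add_assoc, hB1, hB1]
      linear_combination ih - this
  have hex : ∀ x ∈ Subgroup.zpowers s, ∃ i : ℕ, s ^ i = x := fun x hx => by
    rwa [← mem_powers_iff_mem_zpowers] at hx
  let b : G → k := fun x => if h : ∃ i : ℕ, s ^ i = x then B h.choose else 0
  have hb : ∀ i, b (s ^ i) = B i := by
    intro i
    have h : ∃ j : ℕ, s ^ j = s ^ i := ⟨i, rfl⟩
    simp only [b, dif_pos h]
    exact hBeq _ _ h.choose_spec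
  refine ⟨b, fun x hx y hy => ?_⟩
  obtain ⟨i, rfl⟩ := hex x hx
  obtain ⟨j, rfl⟩ := hex y hy
  rw [← pow_add, hb, hb, hb, hmain]

/-- The sum of a 2-cocycle along the powers of an element that is conjugate to its inverse. -/
lemma two_mul_sum_eq_zero [Finite G] {f : G → G → k} (hf : IsTrivialCocycle f) {s w : G}
    (hw : w * s * w⁻¹ = s⁻¹) (hs : (orderOf s : k) = 0) :
    2 * ∑ i ∈ Finset.range (orderOf s), f (s ^ i) s = 0 := by
  classical
  have := Fintype.ofFinite (Subgroup.zpowers s)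
  have hrange : ∀ F : G → k, ∑ i ∈ Finset.range (orderOf s), F (s ^ i)
      = ∑ c : Subgroup.zpowers s, F c := by
    intro F
    rw [← Fin.sum_univ_eq_sum_range fun i => F (s ^ i)]
    refine Fintype.sum_equiv (finEquivZPowers (isOfFinOrder_of_finite s)) _ _ fun i => ?_
    rw [finEquivZPowers_apply]
  have hcard : ((Fintype.card (Subgroup.zpowers s) : ℕ) : k) = 0 := by
    rw [← Nat.card_eq_fintype_card, Nat.card_zpowers, hs]
  let S : Subgroup.zpowers s := ⟨s, Subgroup.mem_zpowers s⟩
  have hmul : ∀ F : G → k, ∑ c : Subgroup.zpowers s, F (c * s)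
      = ∑ c : Subgroup.zpowers s, F c := fun F =>
    Fintype.sum_equiv (Equiv.mulRight S) _ _ fun c => rfl
  have hinv : ∀ F : G → k, ∑ c : Subgroup.zpowers s, F ((c : G)⁻¹)
      = ∑ c : Subgroup.zpowers s, F c := fun F =>
    Fintype.sum_equiv (Equiv.inv _) _ _ fun c => rfl
  have hconj : ∀ c ∈ Subgroup.zpowers s, w * c * w⁻¹ = c⁻¹ := by
    rintro _ ⟨i, rfl⟩
    simp only
    rw [← conj_zpow, hw, inv_zpow]
  -- Inner automorphisms act trivially on cohomology: up to sign, `h` is the cochain whose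
  -- coboundary is the difference between `f` and its conjugate by `w`.
  let h : G → k := fun x => f w x - f (w * x * w⁻¹) w
  have hcob : ∀ x y, f (w * x * w⁻¹) (w * y * w⁻¹) - f x y = h (x * y) - h x - h y := by
    intro x y
    have h1 := hf (w * x * w⁻¹) (w * y * w⁻¹) w
    have h2 := hf (w * x * w⁻¹) w y
    have h3 := hf w x y
    simp only [inv_mul_cancel_right] at h1 h2
    have h4 : w * x * w⁻¹ * (w * y * w⁻¹) = w * (x * y) * w⁻¹ := by group
    rw [h4] at h1
    simp only [h]
    linear_combination h1 - h2 + h3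
  rw [hrange fun c => f c s]
  -- Conjugation by `w` inverts `⟨s⟩`; the terms of the coboundary of `h` cancel in the sum, up to
  -- `|⟨s⟩| * h s = 0`.
  have e1 : ∑ c : Subgroup.zpowers s, f c s⁻¹ = ∑ c : Subgroup.zpowers s, f c s := by
    rw [← sub_eq_zero, ← hinv fun c => f c s⁻¹, ← Finset.sum_sub_distrib]
    have : ∀ c : Subgroup.zpowers s, f (c : G)⁻¹ s⁻¹ - f c s = h (c * s) - h c - h s := by
      intro c
      rw [← hcob, hconj c c.2, hw]
    rw [Finset.sum_congr rfl fun c _ => this c, Finset.sum_sub_distrib, Finset.sum_sub_distrib,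
      hmul h, Finset.sum_const, Finset.card_univ, nsmul_eq_mul, hcard]
    ring
  -- By the cocycle identity at `(c, s, s⁻¹)` the paired terms are constant in `c`, and `|⟨s⟩| = 0`
  -- in `k`.
  have e2 : ∑ c : Subgroup.zpowers s, f c s + ∑ c : Subgroup.zpowers s, f c s⁻¹ = 0 := by
    rw [← hmul fun c => f c s⁻¹, ← Finset.sum_add_distrib]
    have : ∀ c : Subgroup.zpowers s, f c s + f (c * s) s⁻¹ = f s s⁻¹ + f 1 1 := by
      intro c
      have := hf c s s⁻¹
      rw [mul_inv_cancel, hf.one_right] at this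
      linear_combination this
    rw [Finset.sum_congr rfl fun c _ => this c, Finset.sum_const, Finset.card_univ, nsmul_eq_mul,
      hcard, zero_mul]
  linear_combination e2 - e1

end IsTrivialCocycle

end Cochains

end ModularRep

/-! ### First and second cohomology with trivial coefficients. -/

namespace ModularRep

open groupCohomology

section TrivialCoefficients

variable {p : ℕ} [Fact p.Prime] {G : Type} [Group G]

lemma isTrivialCocycle (f : cocycles₂ (Rep.trivial (ZMod p) G (ZMod p))) :
    IsTrivialCocycle fun x y => (f (x, y) : ZMod p) := by
  intro x y z
  simpa using (mem_cocycles₂_iff (f : G × G → _)).1 f.2 x y z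

lemma mem_coboundaries₂_trivial (f : G × G → ZMod p) :
    f ∈ coboundaries₂ (Rep.trivial (ZMod p) G (ZMod p)) ↔
      ∃ a : G → ZMod p, ∀ x y, f (x, y) = a x + a y - a (x * y) := by
  constructor
  · rintro ⟨a, rfl⟩
    refine ⟨a, fun x y => ?_⟩
    rw [d₁₂_hom_apply]
    change (a y : ZMod p) - a (x * y) + a x = a x + a y - a (x * y)
    ring
  · rintro ⟨a, ha⟩
    refine ⟨a, funext fun ⟨x, y⟩ => ?_⟩
    rw [d₁₂_hom_apply, ha]
    change a y - a (x * y) + a x = a x + a y - a (x * y)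
    ring

/-- The sum of a 2-cocycle along the powers of an element. -/
def sumAlong (p : ℕ) [Fact p.Prime] (s : G) :
    cocycles₂ (Rep.trivial (ZMod p) G (ZMod p)) →ₗ[ZMod p] ZMod p where
  toFun f := ∑ i ∈ Finset.range (orderOf s), f.1 (s ^ i, s)
  map_add' _ _ := Finset.sum_add_distrib
  map_smul' _ _ := (Finset.mul_sum _ _ _).symm

/-- A vanishing sum splits the cocycle on `⟨s⟩`, and index prime to `p` extends the splitting to
`G`. Conversely, the sum of a coboundary telescopes to a multiple of `p ^ n`. -/
lemma sumAlong_eq_zero_iff [Finite G] {s : G} {n : ℕ} (hn : n ≠ 0) (hs : orderOf s = p ^ n)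
    (hindex : ¬ p ∣ (Subgroup.zpowers s).index)
    (f : cocycles₂ (Rep.trivial (ZMod p) G (ZMod p))) :
    sumAlong p s f = 0 ↔ H2π _ f = 0 := by
  have hs0 : (orderOf s : ZMod p) = 0 := by
    rw [hs, Nat.cast_pow, CharP.cast_eq_zero, zero_pow hn]
  rw [H2π_eq_zero_iff, mem_coboundaries₂_trivial]
  constructor
  · intro h
    obtain ⟨b, hb⟩ := (isTrivialCocycle f).exists_of_zpowers s h
    exact (isTrivialCocycle f).exists_of_subgroup _
      (by rwa [Ne, ZMod.natCast_eq_zero_iff]) b hb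
  · rintro ⟨a, ha⟩
    change ∑ i ∈ Finset.range (orderOf s), f (s ^ i, s) = 0
    have : ∀ i : ℕ, f (s ^ i, s) = a s - (a (s ^ (i + 1)) - a (s ^ i)) := fun i => by
      rw [ha, pow_succ]
      ring
    simp only [this]
    rw [Finset.sum_sub_distrib, Finset.sum_range_sub (fun i => a (s ^ i)), Finset.sum_const,
      Finset.card_range, nsmul_eq_mul, hs0, pow_orderOf_eq_one, pow_zero]
    ring

/-- Additive maps to `ZMod p` are determined by their value at a generator of a cyclic subgroup of
index prime to `p`. -/
lemma cocycle₁_eq_zero_iff [Finite G] {s : G}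
    (hindex : ¬ p ∣ (Subgroup.zpowers s).index)
    (f : cocycles₁ (Rep.trivial (ZMod p) G (ZMod p))) :
    f s = 0 ↔ f = 0 := by
  refine ⟨fun h => ?_, fun h => by rw [h]; rfl⟩
  have hmul : ∀ x y, f (x * y) = f x + f y := cocycles₁_map_mul_of_isTrivial f
  let φ : G →* Multiplicative (ZMod p) :=
    MonoidHom.mk' (fun x => Multiplicative.ofAdd (f x)) fun x y => by rw [hmul]; rfl
  have hker : Subgroup.zpowers s ≤ φ.ker := by
    rw [Subgroup.zpowers_le]
    exact congrArg Multiplicative.ofAdd h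
  have hdvd := Subgroup.index_dvd_of_le hker
  have htop : φ.ker.index = 1 := by
    have h1 : φ.ker.index ∣ p := by
      rw [Subgroup.index_ker]
      have := Subgroup.card_subgroup_dvd_card φ.range
      rwa [Nat.card_congr Multiplicative.toAdd, Nat.card_zmod] at this
    rcases (Nat.dvd_prime Fact.out).1 h1 with h2 | h2
    · exact h2
    · rw [h2] at hdvd
      exact absurd hdvd hindex
  rw [Subgroup.index_eq_one] at htop
  ext x
  have : x ∈ φ.ker := by rw [htop]; trivial
  exact Multiplicative.ofAdd.injective this

/-- A homomorphism to an abelian group agrees on the conjugate elements `s` and `s⁻¹`, so it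
vanishes at `s` as `p` is odd, and its value there determines it. -/
lemma subsingleton_H1_trivial [Finite G] {s w : G} (hp : p ≠ 2)
    (hindex : ¬ p ∣ (Subgroup.zpowers s).index) (hw : w * s * w⁻¹ = s⁻¹) :
    Subsingleton (H1 (Rep.trivial (ZMod p) G (ZMod p))) := by
  have h2 : (2 : ZMod p) ≠ 0 := Ring.two_ne_zero (by rwa [ZMod.ringChar_zmod_n])
  refine ⟨fun a b => ?_⟩
  have : ∀ a : H1 (Rep.trivial (ZMod p) G (ZMod p)), a = 0 := by
    intro a
    induction a using H1_induction_on with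
    | h f =>
      have hmul : ∀ x y, f (x * y) = f x + f y := cocycles₁_map_mul_of_isTrivial f
      have h1 : ∀ x, f x⁻¹ = - f x := fun x => by
        have := hmul x x⁻¹
        rw [mul_inv_cancel, cocycles₁_map_one] at this
        exact eq_neg_of_add_eq_zero_right this.symm
      have h3 : f s = 0 := by
        have h4 : f (w * s * w⁻¹) = f s⁻¹ := by rw [hw]
        rw [hmul, hmul, h1, h1] at h4
        have h5 : (2 : ZMod p) * f s = 0 := by
          have h6 : (f w : ZMod p) + f s + -f w = - f s := h4
          linear_combination h6
        exact (mul_eq_zero.1 h5).resolve_left h2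
      rw [(cocycle₁_eq_zero_iff hindex f).1 h3, map_zero]
  rw [this a, this b]

lemma subsingleton_H2_trivial [Finite G] {s w : G} (hp : p ≠ 2) {n : ℕ} (hn : n ≠ 0)
    (hs : orderOf s = p ^ n)
    (hindex : ¬ p ∣ (Subgroup.zpowers s).index) (hw : w * s * w⁻¹ = s⁻¹) :
    Subsingleton (H2 (Rep.trivial (ZMod p) G (ZMod p))) := by
  have h2 : (2 : ZMod p) ≠ 0 := Ring.two_ne_zero (by rwa [ZMod.ringChar_zmod_n])
  have hs0 : (orderOf s : ZMod p) = 0 := by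
    rw [hs, Nat.cast_pow, CharP.cast_eq_zero, zero_pow hn]
  refine ⟨fun a b => ?_⟩
  have : ∀ a : H2 (Rep.trivial (ZMod p) G (ZMod p)), a = 0 := by
    intro a
    induction a using H2_induction_on with
    | h f =>
      rw [← sumAlong_eq_zero_iff hn hs hindex]
      exact (mul_eq_zero.1 ((isTrivialCocycle f).two_mul_sum_eq_zero hw hs0)).resolve_left h2
  rw [this a, this b]

lemma nonempty_equiv_of_ker_eq {k A B C : Type*} [Field k] [AddCommGroup A] [Module k A]
    [AddCommGroup B] [Module k B] [AddCommGroup C] [Module k C] (f : A →ₗ[k] B) (g : A →ₗ[k] C)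
    (hf : Function.Surjective f) (hg : Function.Surjective g) (h : ∀ a, f a = 0 ↔ g a = 0) :
    Nonempty (B ≃ₗ[k] C) :=
  ⟨(f.quotKerEquivOfSurjective hf).symm.trans
    ((Submodule.quotEquivOfEq _ _ (Submodule.ext h)).trans (g.quotKerEquivOfSurjective hg))⟩

lemma surjective_of_ne_zero {k A : Type*} [Field k] [AddCommGroup A] [Module k A]
    (f : A →ₗ[k] k) {a : A} (ha : f a ≠ 0) : Function.Surjective f := fun c =>
  ⟨(c / f a) • a, by rw [map_smul, smul_eq_mul, div_mul_cancel₀ _ ha]⟩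

/-- Evaluation at `s` is injective on homomorphisms to `ZMod p`, and the reduction of `π` modulo `p`
takes the value `1`. -/
lemma nonempty_H1_trivial_equiv [Finite G] {s : G} {n : ℕ} (hn : n ≠ 0)
    (hindex : ¬ p ∣ (Subgroup.zpowers s).index) (π : G →* Multiplicative (ZMod (p ^ n)))
    (hπ : π s = Multiplicative.ofAdd 1) :
    Nonempty (H1 (Rep.trivial (ZMod p) G (ZMod p)) ≃ₗ[ZMod p] ZMod p) := by
  let A := Rep.trivial (ZMod p) G (ZMod p)
  let ev : cocycles₁ A →ₗ[ZMod p] ZMod p :=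
    { toFun := fun f => f s
      map_add' := fun _ _ => rfl
      map_smul' := fun _ _ => rfl }
  let c : ZMod (p ^ n) →+* ZMod p := ZMod.castHom (dvd_pow_self p hn) _
  let f₀ : cocycles₁ A := ⟨fun x => c (Multiplicative.toAdd (π x)), by
    rw [mem_cocycles₁_iff]
    intro x y
    rw [map_mul, toAdd_mul, map_add, add_comm]
    rfl⟩
  have hev : ev f₀ ≠ 0 := by
    change c (Multiplicative.toAdd (π s)) ≠ 0
    rw [hπ, toAdd_ofAdd, map_one]
    exact one_ne_zero
  refine nonempty_equiv_of_ker_eq (H1π A).hom ev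
    ((ModuleCat.epi_iff_surjective _).1 inferInstance) (surjective_of_ne_zero ev hev) fun f => ?_
  change H1π A f = 0 ↔ f s = 0
  rw [cocycle₁_eq_zero_iff hindex, H1π_eq_zero_iff, coboundaries₁_eq_bot_of_isTrivial,
    Submodule.mem_bot]
  exact ⟨fun h => DFunLike.coe_injective h, fun h => by rw [h]; rfl⟩

/-- The carry in the addition of two residues. -/
def carry {N : ℕ} (a b : ZMod N) : ℕ := (a.val + b.val) / N

/-- `N` times either side is `a.val + b.val + c.val - (a + b + c).val`. -/
lemma carry_cocycle {N : ℕ} [NeZero N] (a b c : ZMod N) :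
    carry (a + b) c + carry a b = carry b c + carry a (b + c) := by
  have h : ∀ a b : ZMod N, (a + b).val + N * carry a b = a.val + b.val := fun a b => by
    rw [ZMod.val_add, carry, Nat.mod_add_div]
  have h1 := h (a + b) c
  have h2 := h a b
  have h3 := h b c
  have h4 := h a (b + c)
  rw [← add_assoc] at h4
  apply Nat.eq_of_mul_eq_mul_left (NeZero.pos N)
  linarith

/-- Only the step from `N - 1` to `0` carries. -/
lemma sum_carry {N : ℕ} (hN : 1 < N) :
    ∑ i ∈ Finset.range N, carry (i : ZMod N) 1 = 1 := by
  obtain ⟨M, rfl⟩ : ∃ M, N = M + 1 := ⟨N - 1, by omega⟩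
  have : Fact (1 < M + 1) := ⟨hN⟩
  rw [Finset.sum_range_succ, Finset.sum_eq_zero]
  · rw [carry, ZMod.val_natCast_of_lt (by omega), ZMod.val_one, Nat.div_self (by omega)]
  · intro i hi
    rw [Finset.mem_range] at hi
    rw [carry, ZMod.val_natCast_of_lt (by omega), ZMod.val_one, Nat.div_eq_of_lt (by omega)]

/-- `sumAlong` has the coboundaries as its kernel, and it takes the value `1` at the carry cocycle
pulled back along `π`. -/
lemma nonempty_H2_trivial_equiv [Finite G] {s : G} {n : ℕ} (hn : n ≠ 0) (hs : orderOf s = p ^ n)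
    (hindex : ¬ p ∣ (Subgroup.zpowers s).index) (π : G →* Multiplicative (ZMod (p ^ n)))
    (hπ : π s = Multiplicative.ofAdd 1) :
    Nonempty (H2 (Rep.trivial (ZMod p) G (ZMod p)) ≃ₗ[ZMod p] ZMod p) := by
  let A := Rep.trivial (ZMod p) G (ZMod p)
  have hp : p.Prime := Fact.out
  have : NeZero (p ^ n) := ⟨pow_ne_zero _ hp.ne_zero⟩
  let c : G × G → ZMod p := fun x =>
    (carry (Multiplicative.toAdd (π x.1)) (Multiplicative.toAdd (π x.2)) : ℕ)
  let f₀ : cocycles₂ A := ⟨c, by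
    rw [mem_cocycles₂_iff]
    intro x y z
    change c (x * y, z) + c (x, y) = c (y, z) + c (x, y * z)
    simp only [c, map_mul, toAdd_mul]
    exact_mod_cast congrArg (Nat.cast : ℕ → ZMod p) (carry_cocycle _ _ _)⟩
  have h0 : sumAlong p s f₀ ≠ 0 := by
    have : sumAlong p s f₀ = (∑ i ∈ Finset.range (p ^ n), carry (i : ZMod (p ^ n)) 1 : ℕ) := by
      change ∑ i ∈ Finset.range (orderOf s), c (s ^ i, s) = _
      rw [hs, Nat.cast_sum]
      refine Finset.sum_congr rfl fun i _ => ?_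
      simp only [c, map_pow, hπ, toAdd_pow, toAdd_ofAdd, nsmul_eq_mul, mul_one]
    rw [this, sum_carry (Nat.one_lt_pow hn hp.one_lt)]
    simp
  exact nonempty_equiv_of_ker_eq (H2π A).hom (sumAlong p s)
    ((ModuleCat.epi_iff_surjective _).1 inferInstance) (surjective_of_ne_zero _ h0)
    fun f => (sumAlong_eq_zero_iff hn hs hindex f).symm

end TrivialCoefficients

end ModularRep

/-! ### Direct sums, Shapiro's lemma and the cohomology of the irreducible module. -/

namespace ModularRep

open MulAction CategoryTheory

instance groupCohomology_functor_additive (k G : Type) [CommRing k] [Group G] (n : ℕ) :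
    (groupCohomology.functor k G n).Additive where
  map_add {A B f g} := by
    change (groupCohomology.cochainsFunctor k G ⋙
      HomologicalComplex.homologyFunctor (ModuleCat k) _ n).map (f + g) = _
    rw [Functor.map_add]
    rfl

/-- A summand with vanishing cohomology does not contribute to the cohomology of a product. -/
lemma nonempty_cohomology_prod_equiv {k G : Type} [CommRing k] [Group G] (A B : Rep.{0} k G)
    (n : ℕ) (hA : Subsingleton (groupCohomology A n)) :
    Nonempty (groupCohomology (Rep.of (A.ρ.prod B.ρ)) n ≃ₗ[k] groupCohomology B n) := by
  let F := groupCohomology.functor k G n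
  let W : Rep.{0} k G := Rep.of (A.ρ.prod B.ρ)
  let fst : W ⟶ A := Rep.ofHom (Representation.IntertwiningMap.fst k A.ρ B.ρ)
  let snd : W ⟶ B := Rep.ofHom (Representation.IntertwiningMap.snd k A.ρ B.ρ)
  let inl : A ⟶ W := Rep.ofHom (Representation.IntertwiningMap.inl k A.ρ B.ρ)
  let inr : B ⟶ W := Rep.ofHom (Representation.IntertwiningMap.inr k A.ρ B.ρ)
  have h1 : inr ≫ snd = 𝟙 B := by
    ext v
    rfl
  have h2 : fst ≫ inl + snd ≫ inr = 𝟙 W := by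
    apply Rep.hom_ext
    exact Representation.IntertwiningMap.coprod_inl_inr
  have h3 : F.map fst = 0 := by
    ext v
    exact Subsingleton.elim (α := groupCohomology A n) _ _
  let e : F.obj W ≅ F.obj B :=
    { hom := F.map snd
      inv := F.map inr
      hom_inv_id := by
        have := congrArg F.map h2
        rwa [F.map_add, F.map_comp, h3, Limits.zero_comp, zero_add, F.map_comp, F.map_id] at this
      inv_hom_id := by rw [← F.map_comp, h1, F.map_id] }
  exact ⟨e.toLinearEquiv⟩

namespace IsRankOneData

section Orders

variable {p n : ℕ} [Fact p.Prime] {G X : Type*} [Group G] [MulAction G X]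
  {x₀ : X} {s w : G} {π : stabilizer G x₀ →* Multiplicative (ZMod (p ^ n))}

omit [Fact p.Prime] in
lemma orderOf_sStab (D : IsRankOneData p n x₀ s w π) : orderOf D.sStab = p ^ n := by
  refine Nat.dvd_antisymm (orderOf_dvd_of_pow_eq_one D.sStab_pow) ?_
  have h := orderOf_map_dvd π D.sStab
  rwa [map_sStab, orderOf_ofAdd_eq_addOrderOf, ZMod.addOrderOf_one] at h

omit [Fact p.Prime] in
lemma orderOf_s (D : IsRankOneData p n x₀ s w π) : orderOf s = p ^ n := by
  rw [← D.orderOf_sStab]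
  exact Subgroup.orderOf_coe D.sStab

/-- `⟨s⟩` and the image of `π` have the same order `p ^ n`, so the index is `|π.ker|`. -/
lemma not_dvd_index_zpowers_sStab [Finite G] (D : IsRankOneData p n x₀ s w π) :
    ¬ p ∣ (Subgroup.zpowers D.sStab).index := by
  have hp : p.Prime := Fact.out
  have : NeZero (p ^ n) := ⟨pow_ne_zero _ hp.ne_zero⟩
  have hsurj : Function.Surjective π := by
    intro a
    refine ⟨D.sStab ^ (Multiplicative.toAdd a).val, ?_⟩
    rw [map_pow, map_sStab, ← ofAdd_nsmul]
    simp
  have h1 := (Subgroup.zpowers D.sStab).card_mul_index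
  have h2 := π.ker.card_mul_index
  rw [Nat.card_zpowers, D.orderOf_sStab] at h1
  rw [Subgroup.index_ker, MonoidHom.range_eq_top.2 hsurj, Subgroup.card_top,
    Nat.card_congr Multiplicative.toAdd, Nat.card_zmod, ← h1, mul_comm] at h2
  rw [← Nat.eq_of_mul_eq_mul_left (NeZero.pos (p ^ n)) h2]
  exact D.card_ker

/-- The index is the one in the stabilizer times `|X|`, which is `2` modulo `p`. -/
lemma not_dvd_index_zpowers_s [Finite G] (D : IsRankOneData p n x₀ s w π) :
    ¬ p ∣ (Subgroup.zpowers s).index := by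
  have hp : p.Prime := Fact.out
  have hmap : (Subgroup.zpowers D.sStab).map (stabilizer G x₀).subtype = Subgroup.zpowers s := by
    rw [MonoidHom.map_zpowers]
    rfl
  have : IsPretransitive G X := ⟨fun x y => ⟨D.rep y * (D.rep x)⁻¹, by
    rw [mul_smul, inv_smul_eq_iff.2 (D.rep_smul x).symm, D.rep_smul]⟩⟩
  rw [← hmap, Subgroup.index_map_subtype, index_stabilizer_of_transitive, hp.dvd_mul, not_or]
  refine ⟨D.not_dvd_index_zpowers_sStab, ?_⟩
  rw [← ZMod.natCast_eq_zero_iff, D.card_points]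
  exact D.two_ne_zero

end Orders

section Cohomology

variable {p n : ℕ} [Fact p.Prime] {G X : Type} [Group G] [MulAction G X] [Finite X]
  {x₀ : X} {s w : G} {π : stabilizer G x₀ →* Multiplicative (ZMod (p ^ n))}

/-- The permutation module is coinduced from the trivial module of a point stabilizer. -/
lemma nonempty_equiv_coind (D : IsRankOneData p n x₀ s w π) :
    Nonempty ((Representation.ofMulAction (ZMod p) G X).Equiv
      (Representation.coind (stabilizer G x₀).subtype
        (Representation.trivial (ZMod p) (stabilizer G x₀) (ZMod p)))) := by
  let Φ : (Representation.ofMulAction (ZMod p) G X).IntertwiningMap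
      (Representation.coind (stabilizer G x₀).subtype
        (Representation.trivial (ZMod p) (stabilizer G x₀) (ZMod p))) :=
    { toFun := fun v => ⟨fun g => v.coeff (g⁻¹ • x₀), fun b g => by
        have : ((b : G)⁻¹) • x₀ = x₀ := inv_smul_eq_iff.2 b.2.symm
        simp [mul_smul, this]⟩
      map_add' := fun _ _ => rfl
      map_smul' := fun _ _ => rfl
      isIntertwining' := fun g => by
        refine LinearMap.ext fun v => Subtype.ext (funext fun h => ?_)
        change (Representation.ofMulAction (ZMod p) G X g v).coeff (h⁻¹ • x₀)
          = v.coeff ((h * g)⁻¹ • x₀)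
        rw [Representation.coeff_ofMulAction, mul_inv_rev, mul_smul] }
  refine ⟨Φ.ofBijective ⟨?_, ?_⟩⟩
  · intro u v huv
    ext x
    have := congrFun (congrArg Subtype.val huv) (D.rep x)⁻¹
    change u.coeff ((D.rep x)⁻¹⁻¹ • x₀) = v.coeff ((D.rep x)⁻¹⁻¹ • x₀) at this
    rwa [inv_inv, D.rep_smul] at this
  · intro f
    refine ⟨MonoidAlgebra.ofCoeff (Finsupp.equivFunOnFinite.symm fun x => f.1 (D.rep x)⁻¹),
      Subtype.ext (funext fun g => ?_)⟩
    change f.1 (D.rep (g⁻¹ • x₀))⁻¹ = f.1 g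
    have hb : (D.rep (g⁻¹ • x₀))⁻¹ * g⁻¹ ∈ stabilizer G x₀ := by
      rw [mem_stabilizer_iff, mul_smul, inv_smul_eq_iff, D.rep_smul]
    have := f.2 ⟨_, hb⟩ g
    simpa using this

/-- The cohomology of the permutation module is computed in two ways: by its splitting, where the
trivial summand contributes nothing, and by Shapiro's lemma. -/
lemma nonempty_cohomology_equiv [Finite G] (D : IsRankOneData p n x₀ s w π)
    {V : Rep.{0} (ZMod p) G} (hV : IsNonprincipalIrreducibleInPrincipalBlock V.ρ) (i : ℕ)
    (hi : Subsingleton (groupCohomology (Rep.trivial (ZMod p) G (ZMod p)) i)) :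
    Nonempty (groupCohomology V i ≃ₗ[ZMod p]
      groupCohomology (Rep.trivial (ZMod p) (stabilizer G x₀) (ZMod p)) i) := by
  obtain ⟨e₁⟩ := D.nonempty_equiv_coind
  obtain ⟨e₂⟩ := D.nonempty_equiv hV
  obtain ⟨e₃⟩ := nonempty_cohomology_prod_equiv (Rep.trivial (ZMod p) G (ZMod p)) V i hi
  let j := (groupCohomology.functor (ZMod p) G i).mapIso
    (Rep.mkIso (e₂.symm.trans e₁))
  exact ⟨e₃.symm.trans (j.toLinearEquiv.trans (groupCohomology.coindIso
    (Rep.trivial (ZMod p) (stabilizer G x₀) (ZMod p)) i).toLinearEquiv)⟩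

theorem nonempty_H1_equiv [Finite G] (D : IsRankOneData p n x₀ s w π)
    {V : Rep.{0} (ZMod p) G} (hV : IsNonprincipalIrreducibleInPrincipalBlock V.ρ) :
    Nonempty (groupCohomology V 1 ≃ₗ[ZMod p] ZMod p) := by
  obtain ⟨e₁⟩ := D.nonempty_cohomology_equiv hV 1
    (subsingleton_H1_trivial D.odd D.not_dvd_index_zpowers_s D.conj)
  obtain ⟨e₂⟩ := nonempty_H1_trivial_equiv D.pos D.not_dvd_index_zpowers_sStab π D.map_sStab
  exact ⟨e₁.trans e₂⟩

theorem nonempty_H2_equiv [Finite G] (D : IsRankOneData p n x₀ s w π)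
    {V : Rep.{0} (ZMod p) G} (hV : IsNonprincipalIrreducibleInPrincipalBlock V.ρ) :
    Nonempty (groupCohomology V 2 ≃ₗ[ZMod p] ZMod p) := by
  obtain ⟨e₁⟩ := D.nonempty_cohomology_equiv hV 2
    (subsingleton_H2_trivial D.odd D.pos D.orderOf_s D.not_dvd_index_zpowers_s D.conj)
  obtain ⟨e₂⟩ := nonempty_H2_trivial_equiv D.pos D.orderOf_sStab D.not_dvd_index_zpowers_sStab π
    D.map_sStab
  exact ⟨e₁.trans e₂⟩

lemma finrank_add_one [Finite G] (D : IsRankOneData p n x₀ s w π) {V : Type*} [AddCommGroup V]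
    [Module (ZMod p) V] {ρ : Representation (ZMod p) G V}
    (hρ : IsNonprincipalIrreducibleInPrincipalBlock ρ) :
    Module.finrank (ZMod p) V + 1 = Nat.card X := by
  have := Fintype.ofFinite X
  obtain ⟨e⟩ := D.nonempty_equiv hρ
  let c : MonoidAlgebra (ZMod p) X ≃ₗ[ZMod p] (X →₀ ZMod p) := MonoidAlgebra.coeffLinearEquiv _
  have : Module.Finite (ZMod p) (ZMod p × V) :=
    Module.Finite.equiv (c.symm.trans e.toLinearEquiv)
  have : Module.Finite (ZMod p) V :=
    Module.Finite.of_surjective (LinearMap.snd (ZMod p) (ZMod p) V) LinearMap.snd_surjective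
  have h := (c.symm.trans e.toLinearEquiv).finrank_eq
  rw [Module.finrank_prod, Module.finrank_self, Module.finrank_finsupp_self] at h
  rw [Nat.card_eq_fintype_card]
  omega

end Cohomology

end IsRankOneData

end ModularRep

/-! ### The Borel subgroup and its action on the projective line. -/

namespace PSL2

open MulAction Matrix

variable {F : Type*} [Field F]

/-- The point at infinity of the projective line. -/
def infPoint (F : Type*) [Field F] : ℙ F (Fin 2 → F) :=
  Projectivization.mk F ![1, 0] (by simp)

/-- Upper unitriangular matrices. -/
def upper (t : F) : SL(2, F) := ⟨!![1, t; 0, 1], by simp⟩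

/-- Diagonal matrices of determinant one. -/
def diag (a : Fˣ) : SL(2, F) := ⟨!![(a : F), 0; 0, ((a⁻¹ : Fˣ) : F)], by simp⟩

variable (F) in
/-- A representative of the nontrivial element of the Weyl group. -/
def weyl : SL(2, F) := ⟨!![0, 1; -1, 0], by simp⟩

lemma upper_coe (t : F) : (upper t : Matrix (Fin 2) (Fin 2) F) = !![1, t; 0, 1] := rfl

lemma diag_coe (a : Fˣ) :
    (diag a : Matrix (Fin 2) (Fin 2) F) = !![(a : F), 0; 0, ((a⁻¹ : Fˣ) : F)] := rfl

lemma weyl_coe : (weyl F : Matrix (Fin 2) (Fin 2) F) = !![0, 1; -1, 0] := rfl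

lemma upper_zero : upper (0 : F) = 1 :=
  Subtype.ext Matrix.one_fin_two.symm

lemma upper_mul (t u : F) : upper t * upper u = upper (u + t) := by
  apply Subtype.ext
  rw [Matrix.SpecialLinearGroup.coe_mul]
  simp [upper_coe]

lemma upper_pow (t : F) (j : ℕ) : upper t ^ j = upper (j * t) := by
  induction j with
  | zero => simp [upper_zero]
  | succ j ih =>
    rw [pow_succ, ih, upper_mul]
    congr 1
    push_cast
    ring

lemma diag_mul (a b : Fˣ) : diag (a * b) = diag a * diag b := by
  apply Subtype.ext
  rw [Matrix.SpecialLinearGroup.coe_mul]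
  simp [diag_coe, mul_comm]

lemma diag_one : diag (1 : Fˣ) = 1 := by
  apply Subtype.ext
  simp [diag_coe, Matrix.one_fin_two]

lemma diag_pow (a : Fˣ) (j : ℕ) : diag (a ^ j) = diag a ^ j := by
  induction j with
  | zero => simp [diag_one]
  | succ j ih => rw [pow_succ, diag_mul, ih, pow_succ]

lemma weyl_mul_diag (a : Fˣ) : weyl F * diag a = diag a⁻¹ * weyl F := by
  apply Subtype.ext
  rw [Matrix.SpecialLinearGroup.coe_mul, Matrix.SpecialLinearGroup.coe_mul]
  simp [diag_coe, weyl_coe]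

lemma diag_inv (a : Fˣ) : diag a⁻¹ = (diag a)⁻¹ := by
  rw [eq_inv_iff_mul_eq_one, ← diag_mul, inv_mul_cancel, diag_one]

lemma smul_infPoint_eq_iff (A : SL(2, F)) : A • infPoint F = infPoint F ↔ A 1 0 = 0 := by
  rw [infPoint, Projectivization.smul_mk, Projectivization.mk_eq_mk_iff']
  constructor
  · rintro ⟨a, ha⟩
    have := congrFun ha 1
    simpa [Matrix.SpecialLinearGroup.smul_def, Matrix.mulVec, dotProduct, Fin.sum_univ_two]
      using this.symm
  · intro h
    refine ⟨A 0 0, ?_⟩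
    ext i
    fin_cases i <;>
      simp [Matrix.SpecialLinearGroup.smul_def, Matrix.mulVec, dotProduct, Fin.sum_univ_two, h]

lemma mem_stabilizer_mk (A : SL(2, F)) :
    (A : PSL(2, F)) ∈ stabilizer PSL(2, F) (infPoint F) ↔ A 1 0 = 0 := by
  rw [mem_stabilizer_iff, Matrix.ProjectiveSpecialLinearGroup.smul_proj_mk, smul_infPoint_eq_iff]

/-- The square of the upper left entry of a matrix, as a function on `PSL(2, F)`. -/
def sqEntry : PSL(2, F) → F :=
  Quotient.lift (fun A : SL(2, F) => (A 0 0) ^ 2) (by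
    -- Central elements are scalars `r` with `r ^ 2 = 1`, so squaring removes the ambiguity.
    intro A B h
    obtain ⟨r, hr, hrA⟩ := Matrix.SpecialLinearGroup.mem_center_iff.1
      (QuotientGroup.leftRel_apply.1 h)
    have hB : B = A * (A⁻¹ * B) := by group
    have hB0 : B 0 0 = A 0 0 * r := by
      conv_lhs => rw [hB, Matrix.SpecialLinearGroup.coe_mul, ← hrA]
      simp
    simp only [Fintype.card_fin] at hr
    rw [hB0, mul_pow, hr, mul_one])

@[simp]
lemma sqEntry_mk (A : SL(2, F)) : sqEntry (A : PSL(2, F)) = (A 0 0) ^ 2 := rfl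

/-- The character of the stabilizer of the point at infinity given by the square of the upper left
entry. -/
def sqChar : stabilizer PSL(2, F) (infPoint F) →* Fˣ :=
  MonoidHom.toHomUnits
    { toFun := fun b => sqEntry (b : PSL(2, F))
      map_one' := by
        change ((1 : SL(2, F)) 0 0) ^ 2 = 1
        simp
      map_mul' := by
        rintro ⟨g, hg⟩ ⟨h, hh⟩
        obtain ⟨A, rfl⟩ := QuotientGroup.mk_surjective g
        obtain ⟨B, rfl⟩ := QuotientGroup.mk_surjective h
        have hB := (mem_stabilizer_mk B).1 hh
        change ((A * B : SL(2, F)) 0 0) ^ 2 = (A 0 0) ^ 2 * (B 0 0) ^ 2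
        rw [Matrix.SpecialLinearGroup.coe_mul,
          Matrix.mul_apply, Fin.sum_univ_two, hB]
        ring }

lemma sqChar_mk (A : SL(2, F)) (hA : (A : PSL(2, F)) ∈ stabilizer PSL(2, F) (infPoint F)) :
    (sqChar ⟨(A : PSL(2, F)), hA⟩ : F) = (A 0 0) ^ 2 := rfl

lemma diag_mem (a : Fˣ) :
    ((diag a : SL(2, F)) : PSL(2, F)) ∈ stabilizer PSL(2, F) (infPoint F) := by
  rw [mem_stabilizer_mk]
  simp [diag]

lemma upper_mem (t : F) :
    ((upper t : SL(2, F)) : PSL(2, F)) ∈ stabilizer PSL(2, F) (infPoint F) := by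
  rw [mem_stabilizer_mk]
  simp [upper]

lemma sqChar_diag (a : Fˣ) : sqChar ⟨_, diag_mem a⟩ = a ^ 2 := by
  ext
  rw [sqChar_mk]
  simp [diag]

lemma sqChar_upper (t : F) : sqChar ⟨_, upper_mem t⟩ = 1 := by
  ext
  rw [sqChar_mk]
  simp [upper]

lemma weyl_smul_infPoint_ne :
    ((weyl F : SL(2, F)) : PSL(2, F)) • infPoint F ≠ infPoint F := by
  rw [Ne, ← mem_stabilizer_iff, mem_stabilizer_mk]
  simp [weyl]

lemma exists_upper_smul_eq {y : ℙ F (Fin 2 → F)} (hy : y ≠ infPoint F) :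
    ∃ t : F, ((upper t : SL(2, F)) : PSL(2, F)) • ((weyl F : SL(2, F)) : PSL(2, F)) • infPoint F
      = y := by
  induction y using Projectivization.ind with
  | h v hv =>
    have h1 : v 1 ≠ 0 := by
      intro h
      apply hy
      rw [infPoint, Projectivization.mk_eq_mk_iff']
      refine ⟨v 0, ?_⟩
      ext i
      fin_cases i <;> simp [h]
    refine ⟨v 0 / v 1, ?_⟩
    rw [Matrix.ProjectiveSpecialLinearGroup.smul_proj_mk,
      Matrix.ProjectiveSpecialLinearGroup.smul_proj_mk, infPoint, Projectivization.smul_mk,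
      Projectivization.smul_mk, Projectivization.mk_eq_mk_iff']
    -- The Weyl representative followed by `upper t` sends `(1, 0)` to `(-t, -1)`.
    refine ⟨-(v 1)⁻¹, ?_⟩
    ext i
    fin_cases i
    · simp [Matrix.SpecialLinearGroup.smul_def, upper_coe, weyl_coe, vecHead, vecTail]
      field_simp
    · simp [Matrix.SpecialLinearGroup.smul_def, upper_coe, weyl_coe, vecHead, vecTail, h1]

/-- An element of the kernel of `sqChar` has order dividing twice the order of the field. -/
lemma pow_eq_one_of_sqChar_eq_one [Finite F] {b : stabilizer PSL(2, F) (infPoint F)}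
    (hb : sqChar b = 1) : b ^ (2 * Nat.card F) = 1 := by
  obtain ⟨g, hg⟩ := b
  obtain ⟨A, rfl⟩ := QuotientGroup.mk_surjective g
  have h10 := (mem_stabilizer_mk A).1 hg
  have h00 : A 0 0 ^ 2 = 1 := by rw [← sqChar_mk A hg, hb]; rfl
  have hdet := A.det_coe
  rw [Matrix.det_fin_two, h10, mul_zero, sub_zero] at hdet
  have h11 : A 1 1 = A 0 0 := by
    calc A 1 1 = A 0 0 ^ 2 * A 1 1 := by rw [h00, one_mul]
      _ = A 0 0 * (A 0 0 * A 1 1) := by ring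
      _ = A 0 0 := by rw [hdet, mul_one]
  -- Such a matrix is upper triangular with equal diagonal entries `±1`. Squaring removes the sign,
  -- and the unipotent result is killed by `|F|`.
  have hA : A ^ 2 = upper (2 * A 0 0 * A 0 1) := by
    apply Subtype.ext
    rw [pow_two, Matrix.SpecialLinearGroup.coe_mul, Matrix.eta_fin_two (A : Matrix _ _ F), h10, h11,
      upper_coe, Matrix.mul_fin_two, ← pow_two, h00]
    congr! 3 <;> simp
    ring
  have hq : A ^ (2 * Nat.card F) = 1 := by
    have := Fintype.ofFinite F
    rw [pow_mul, hA, upper_pow, Nat.card_eq_fintype_card, FiniteField.cast_card_eq_zero, zero_mul,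
      upper_zero]
  apply Subtype.ext
  change ((A : SL(2, F)) : PSL(2, F)) ^ (2 * Nat.card F) = 1
  rw [← QuotientGroup.mk_pow, hq]
  rfl

end PSL2

/-! ### The rank one data of `PSL(2, F)`. -/

namespace PSL2

open MulAction Matrix ModularRep

variable {F : Type*} [Field F]

/-- A homomorphism to `ℤ/N` with prescribed generator, from a homomorphism to the units of a field
with image in the `N`-th roots of unity. -/
lemma exists_hom_zmod {B : Type*} [Group B] {N : ℕ} [NeZero N] {η : Fˣ}
    (hη : IsPrimitiveRoot η N) (χ : B →* Fˣ) (hχ : ∀ b, χ b ^ N = 1) {s : B} (hs : χ s = η) :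
    ∃ π : B →* Multiplicative (ZMod N), π s = Multiplicative.ofAdd 1 ∧ π.ker = χ.ker := by
  have hmem : ∀ b, χ b ∈ Subgroup.zpowers η := fun b => by
    rw [hη.zpowers_eq]
    exact hχ b
  let χ' : B →* Subgroup.zpowers η := χ.codRestrict _ hmem
  let e : Subgroup.zpowers η ≃* Multiplicative (ZMod N) :=
    AddEquiv.toMultiplicativeRight hη.zmodEquivZPowers.symm
  refine ⟨e.toMonoidHom.comp χ', ?_, ?_⟩
  · have h1 : χ' s = ⟨η ^ 1, 1, by simp⟩ := Subtype.ext (hs.trans (pow_one η).symm)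
    have h2 := (hη.zmodEquivZPowers_symm_apply_pow 1).trans Nat.cast_one
    refine congrArg Multiplicative.ofAdd (Eq.trans ?_ h2)
    exact congrArg (fun a => hη.zmodEquivZPowers.symm (Additive.ofMul a)) h1
  · ext b
    rw [MonoidHom.mem_ker, MonoidHom.mem_ker]
    change e (χ' b) = 1 ↔ _
    rw [e.map_eq_one_iff, Subtype.ext_iff]
    rfl

lemma exists_isRankOneData (p : ℕ) [Fact p.Prime] (hp : p ≠ 2) (F : Type*) [Field F] [Finite F]
    (hpF : p ∣ Nat.card F - 1) :
    ∃ (n : ℕ) (s w : PSL(2, F))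
      (π : stabilizer PSL(2, F) (infPoint F) →* Multiplicative (ZMod (p ^ n))),
      IsRankOneData p n (infPoint F) s w π := by
  have hpp : p.Prime := Fact.out
  have := Fintype.ofFinite F
  have hq1 : 1 < Nat.card F := Finite.one_lt_card
  obtain ⟨n, m, hpm, hm⟩ := Nat.exists_eq_pow_mul_and_not_dvd (n := Nat.card F - 1)
    (by omega) p hpp.ne_one
  have hn : n ≠ 0 := by
    rintro rfl
    rw [pow_zero, one_mul] at hm
    exact hpm (hm ▸ hpF)
  have : NeZero (p ^ n) := ⟨pow_ne_zero _ hpp.ne_zero⟩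
  have hm0 : m ≠ 0 := by rintro rfl; simp at hpm
  have hcardU : Nat.card Fˣ = Nat.card F - 1 := Nat.card_units F
  obtain ⟨g, hg⟩ := IsCyclic.exists_ofOrder_eq_natCard (α := Fˣ)
  have hζ : orderOf (g ^ m) = p ^ n := by
    rw [orderOf_pow_of_dvd hm0 (by rw [hg, hcardU, hm]; exact dvd_mul_left _ _), hg, hcardU, hm,
      Nat.mul_div_cancel _ (Nat.pos_of_ne_zero hm0)]
  set ζ := g ^ m
  -- With `|F| - 1 = p ^ n * m`, the `m`-th power lands in the `p ^ n`-th roots of unity. At `diag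
  -- ζ` it is `ζ ^ (2 * m)`, still primitive because `p` divides neither `2` nor `m`.
  let χ : stabilizer PSL(2, F) (infPoint F) →* Fˣ := (powMonoidHom m).comp sqChar
  have hχ : ∀ b, χ b ^ p ^ n = 1 := fun b => by
    change (sqChar b ^ m) ^ p ^ n = 1
    rw [← pow_mul, mul_comm, ← hm, ← hcardU, pow_card_eq_one']
  have hχs : χ ⟨_, diag_mem ζ⟩ = ζ ^ (2 * m) := by
    change sqChar _ ^ m = _
    rw [sqChar_diag, pow_mul]
  have h2p : ¬ p ∣ 2 := fun h => hp ((Nat.prime_dvd_prime_iff_eq hpp Nat.prime_two).1 h)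
  have hη : IsPrimitiveRoot (ζ ^ (2 * m)) (p ^ n) := by
    have hcop : (2 * m).Coprime (p ^ n) := by
      refine Nat.Coprime.pow_right _ (Nat.Coprime.symm ((Nat.Prime.coprime_iff_not_dvd hpp).2 ?_))
      rw [hpp.dvd_mul, not_or]
      exact ⟨h2p, hpm⟩
    exact (hζ ▸ IsPrimitiveRoot.orderOf ζ).pow_of_coprime _ hcop
  obtain ⟨π, hπs, hπker⟩ := exists_hom_zmod hη χ hχ hχs
  refine ⟨n, ((diag ζ : SL(2, F)) : PSL(2, F)), ((weyl F : SL(2, F)) : PSL(2, F)), π, ?_⟩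
  refine
    { pos := hn
      odd := hp
      smul_s := diag_mem ζ
      s_pow := ?_
      map_s := hπs
      conj := ?_
      smul_w := weyl_smul_infPoint_ne
      transitive := ?_
      card_ker := ?_
      card_points := ?_ }
  · rw [← QuotientGroup.mk_pow, ← diag_pow, ← hζ, pow_orderOf_eq_one, diag_one]
    rfl
  · rw [mul_inv_eq_iff_eq_mul, ← QuotientGroup.mk_inv, ← QuotientGroup.mk_mul, weyl_mul_diag,
      diag_inv]
    rfl
  · intro y hy
    obtain ⟨t, ht⟩ := exists_upper_smul_eq hy
    refine ⟨⟨_, upper_mem t⟩, ?_, ht⟩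
    rw [hπker, MonoidHom.mem_ker]
    change sqChar _ ^ m = 1
    rw [sqChar_upper, one_pow]
  -- For an element of order `p` in the kernel, both the `p`-th and the `m`-th power of `sqChar` are
  -- trivial, so `sqChar` is. The order then divides `2 * |F|`, which is prime to `p` since `p` is
  -- odd and divides `|F| - 1`.
  · intro hdvd
    obtain ⟨h, hh⟩ := exists_prime_orderOf_dvd_card' p hdvd
    have h1 : sqChar (h : stabilizer PSL(2, F) (infPoint F)) ^ p = 1 := by
      have h0 : h ^ p = 1 := orderOf_dvd_iff_pow_eq_one.1 hh.dvd
      rw [← map_pow, ← Subgroup.coe_pow, h0, Subgroup.coe_one, map_one]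
    have h2 : sqChar (h : stabilizer PSL(2, F) (infPoint F)) ^ m = 1 := by
      have : (h : stabilizer PSL(2, F) (infPoint F)) ∈ χ.ker := hπker ▸ h.2
      exact this
    have h3 : sqChar (h : stabilizer PSL(2, F) (infPoint F)) = 1 := by
      have hcop : p.Coprime m := (Nat.Prime.coprime_iff_not_dvd hpp).2 hpm
      have := Nat.dvd_gcd (orderOf_dvd_of_pow_eq_one h1) (orderOf_dvd_of_pow_eq_one h2)
      rw [hcop, Nat.dvd_one, orderOf_eq_one_iff] at this
      exact this
    have h4 : h ^ (2 * Nat.card F) = 1 := Subtype.ext (pow_eq_one_of_sqChar_eq_one h3)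
    have h5 := orderOf_dvd_of_pow_eq_one h4
    rw [hh, hpp.dvd_mul] at h5
    have h6 := (Nat.dvd_sub_iff_right hq1.le (h5.resolve_left h2p)).1 hpF
    exact hpp.one_lt.ne' (Nat.dvd_one.1 h6)
  · rw [Projectivization.card_of_finrank_two F (Fin 2 → F) (by simp)]
    have : (Nat.card F - 1 + 2 : ℕ) = Nat.card F + 1 := by omega
    rw [← this, Nat.cast_add, (ZMod.natCast_eq_zero_iff _ _).2 hpF, zero_add]
    rfl

end PSL2

end

theorem theorem2 (p : ℕ) [Fact p.Prime] (hp : p ≠ 2) (F : Type) [Field F] [Finite F]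
    (hpF : p ∣ Nat.card F - 1) :
    (∃ V : Rep.{0} (ZMod p) PSL(2, F),
      ModularRep.IsNonprincipalIrreducibleInPrincipalBlock V.ρ) ∧
    ∀ V : Rep.{0} (ZMod p) PSL(2, F),
      ModularRep.IsNonprincipalIrreducibleInPrincipalBlock V.ρ →
        Module.finrank (ZMod p) V = Nat.card F ∧
        Nonempty ((projectiveLinePermutationModule p F).Equiv
          ((Representation.trivial (ZMod p) PSL(2, F) (ZMod p)).prod V.ρ)) ∧
        Nonempty (groupCohomology V 1 ≃ₗ[ZMod p] ZMod p) ∧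
        Nonempty (groupCohomology V 2 ≃ₗ[ZMod p] ZMod p) := by
  obtain ⟨n, s, w, π, D⟩ := PSL2.exists_isRankOneData p hp F hpF
  have : Finite PSL(2, F) := Quotient.finite _
  refine ⟨⟨Rep.of (ModularRep.IsRankOneData.sumZero p PSL(2, F)
    (ℙ F (Fin 2 → F))).toRepresentation, D.sumZero_spec⟩, fun V hV => ⟨?_, D.nonempty_equiv hV,
    D.nonempty_H1_equiv hV, D.nonempty_H2_equiv hV⟩⟩
  have h := D.finrank_add_one hV
  rw [Projectivization.card_of_finrank_two F (Fin 2 → F) (by simp)] at h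
  exact Nat.succ_injective h
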